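/- Let $s\ge 1$ and let $c_1,\dots,c_s\in(0,1]$ be distinct. Let $P_j(t)=\sqrt{2j-1}\,\hat P_{j-1}(t)$, $j\ge 1$, where $\hat P_{j-1}$ is the shifted Legendre polynomial of degree $j-1$ on $[0,1]$, so that $\int_0^1P_iP_j\,\mathrm dt=\delta_{ij}$. For $y'=f(y)$, $y(t_0)=y_0$, and a stepsize $h>0$, one step of HBVM$(\infty,s)$ is $y_1=\sigma(t_0+h)$, where $\sigma$ is the polynomial of degree at most $s$ with $\sigma(t_0)=y_0$ and $\sigma(t_0+c_ih)=Y_i$, and the stages $Y_1,\dots,Y_s$ solve $$Y_i=y_0+h\sum_{j=1}^s\int_0^{c_i}P_j(x)\,\mathrm dx\int_0^1P_j(\tau)\,f(\sigma(t_0+\tau h))\,\mathrm d\tau,\qquad i=1,\dots,s,$$ with exact integrals. Then, whatever the choice of $c_1,\dots,c_s$, the following hold. (a) HBVM$(\infty,s)$ has order $2s$, and not order $2s+1$, for Hamiltonian problems. Here order $p$ means: for every $m$, every skew-symmetric $J\in\mathbb R^{2m\times 2m}$, every $H$ of class $C^{p+1}$ on an open set $U\subseteq\mathbb R^{2m}$,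 and every $y_0\in U$, with $f=J\nabla H$, there are $\rho>0$, $h_0>0$ and $K$ such that for $0<h\le h_0$ the stage equations have exactly one solution with all $Y_i$ in the closed ball of radius $\rho$ about $y_0$, and the resulting $y_1$ satisfies $\|y_1-y(t_0+h)\|\le K h^{p+1}$ for every solution $y$ in $U$ of $y'=f(y)$, $y(t_0)=y_0$, on $[t_0,t_0+h]$. (b) HBVM$(\infty,s)$ is perfectly $A$-stable: for the test equation $y'=\mu y$, $\mu\in\mathbb C$, the set of $q=h\mu$ for which every step is uniquely solvable and all numerical solutions tend to $0$ is exactly $\{q\in\mathbb C:\operatorname{Re}q<0\}$; and the set of $q$ for which every step is uniquely solvable and all numerical solutions are bounded is exactly $\{q\in\mathbb C:\operatorname{Re}q\le 0\}$. -/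

import Mathlib

noncomputable section

namespace HBVM

/-- The orthonormal polynomials on `[0,1]`, indexed from `0`: `orthoLegendre j` has degree `j` and
equals `√(2j+1)` times the shifted Legendre polynomial `P̂_j(t) = P_j(2t-1)`. Mathlib's
`Polynomial.shiftedLegendre j` is `P_j(1-2t) = (-1)^j P̂_j(t)`, whence the sign. -/
def orthoLegendre (j : ℕ) : Polynomial ℝ :=
  Polynomial.C ((-1) ^ j * Real.sqrt (2 * j + 1)) *
    (Polynomial.shiftedLegendre j).map (Int.castRingHom ℝ)

variable {E : Type*} [NormedAddCommGroup E] [NormedSpace ℝ E]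

/-- `stagePoly c y₀ Y τ = σ(t₀ + τ h)`, where `σ` is the vector polynomial of degree at most `s`
that interpolates `y₀` at `τ = 0` and the fundamental stage `Y i` at `τ = c i`. -/
def stagePoly {s : ℕ} (c : Fin s → ℝ) (y₀ : E) (Y : Fin s → E) (τ : ℝ) : E :=
  ∑ i : Fin (s + 1),
    (Lagrange.basis Finset.univ (Fin.cons 0 c : Fin (s + 1) → ℝ) i).eval τ •
      (Fin.cons y₀ Y : Fin (s + 1) → E) i

/-- The stage equations of HBVM(∞,s) with abscissae `c`, applied to `y' = f(y)` with stepsize `h`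
from `y₀`:
`Y_i = y₀ + h ∑_j (∫_0^{c_i} P_j(x) dx) ∫_0^1 P_j(τ) f(σ(t₀ + τ h)) dτ`, the integrals being exact. -/
def IsStages {s : ℕ} (c : Fin s → ℝ) (f : E → E) (h : ℝ) (y₀ : E) (Y : Fin s → E) : Prop :=
  ∀ i, Y i = y₀ + h • ∑ j : Fin s,
    (∫ x in (0 : ℝ)..(c i), (orthoLegendre j).eval x) •
      ∫ τ in (0 : ℝ)..1, (orthoLegendre j).eval τ • f (stagePoly c y₀ Y τ)

/-- One step `y₀ ↦ y₁ = σ(t₀ + h)` of HBVM(∞,s). -/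
def IsStep {s : ℕ} (c : Fin s → ℝ) (f : E → E) (h : ℝ) (y₀ y₁ : E) : Prop :=
  ∃ Y : Fin s → E, IsStages c f h y₀ Y ∧ y₁ = stagePoly c y₀ Y 1

/-- `y` is a solution in `U` of `y' = f(y)` on `[a, b]` with `y(a) = y₀`. -/
def IsExactSolution (f : E → E) (U : Set E) (a b : ℝ) (y₀ : E) (y : ℝ → E) : Prop :=
  y a = y₀ ∧ ∀ t ∈ Set.Icc a b, y t ∈ U ∧ HasDerivWithinAt y (f (y t)) (Set.Icc a b) t

/-- Local order `p` at the initial value `y₀`: for all small `h > 0` there is exactly one solution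
of the stage equations near `y₀`, and the step that it defines has an error of at most
`K h^(p+1)` against the exact solution. -/
def HasOrderAt {s : ℕ} (c : Fin s → ℝ) (p : ℕ) (f : E → E) (U : Set E) (y₀ : E) : Prop :=
  ∃ ρ > 0, ∃ h₀ > 0, ∃ K : ℝ, ∀ h : ℝ, 0 < h → h ≤ h₀ →
    (∃! Y : Fin s → E, IsStages c f h y₀ Y ∧ ∀ i, Y i ∈ Metric.closedBall y₀ ρ) ∧
    ∀ Y : Fin s → E, IsStages c f h y₀ Y → (∀ i, Y i ∈ Metric.closedBall y₀ ρ) →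
      ∀ (t₀ : ℝ) (y : ℝ → E), IsExactSolution f U t₀ (t₀ + h) y₀ y →
        ‖stagePoly c y₀ Y 1 - y (t₀ + h)‖ ≤ K * h ^ (p + 1)

/-- The Hamiltonian vector field `y ↦ J ∇H(y)`. -/
def hamiltonianField {n : ℕ} (J : Matrix (Fin n) (Fin n) ℝ) (H : EuclideanSpace ℝ (Fin n) → ℝ)
    (y : EuclideanSpace ℝ (Fin n)) : EuclideanSpace ℝ (Fin n) :=
  Matrix.toEuclideanLin J (gradient H y)

/-- HBVM(∞,s) with abscissae `c` has order (at least) `p`: its local error is `O(h^(p+1))` for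
every Hamiltonian problem `y' = J ∇H(y)`, `y(t₀) = y₀ ∈ ℝ^{2m}`, with `J` skew-symmetric and `H`
of class `C^(p+1)` (so that `J ∇H` is of class `C^p`) on an open set containing `y₀`. -/
def HasOrder {s : ℕ} (c : Fin s → ℝ) (p : ℕ) : Prop :=
  ∀ (m : ℕ) (J : Matrix (Fin (2 * m)) (Fin (2 * m)) ℝ)
    (H : EuclideanSpace ℝ (Fin (2 * m)) → ℝ) (U : Set (EuclideanSpace ℝ (Fin (2 * m)))),
    J.transpose = -J → IsOpen U → ContDiffOn ℝ ((p + 1 : ℕ) : WithTop ℕ∞) H U →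
      ∀ y₀ ∈ U, HasOrderAt c p (hamiltonianField J H) U y₀

/-- For the test equation `y' = μ y` and stepsize `h`, every step is uniquely solvable. -/
def TestSolvable {s : ℕ} (c : Fin s → ℝ) (μ : ℂ) (h : ℝ) : Prop :=
  ∀ y₀ : ℂ, ∃! Y : Fin s → ℂ, IsStages c (fun y => μ * y) h y₀ Y

/-- `u 0, u 1, …` is a numerical solution of the test equation `y' = μ y` with stepsize `h`. -/
def IsTestSolution {s : ℕ} (c : Fin s → ℝ) (μ : ℂ) (h : ℝ) (u : ℕ → ℂ) : Prop :=
  ∀ n, IsStep c (fun y => μ * y) h (u n) (u (n + 1))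

/-- The region of absolute stability: the `q = h μ` for which the steps are well defined and all
numerical solutions of the test equation tend to zero. -/
def stabilityRegion {s : ℕ} (c : Fin s → ℝ) : Set ℂ :=
  {q | ∀ (μ : ℂ) (h : ℝ), 0 < h → (h : ℂ) * μ = q →
    TestSolvable c μ h ∧
      ∀ u : ℕ → ℂ, IsTestSolution c μ h u → Filter.Tendsto u Filter.atTop (nhds 0)}

/-- The variant of the region of absolute stability that only asks all numerical solutions of the
test equation to be bounded. -/
def weakStabilityRegion {s : ℕ} (c : Fin s → ℝ) : Set ℂ :=
  {q | ∀ (μ : ℂ) (h : ℝ), 0 < h → (h : ℂ) * μ = q →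
    TestSolvable c μ h ∧
      ∀ u : ℕ → ℂ, IsTestSolution c μ h u → ∃ B : ℝ, ∀ n, ‖u n‖ ≤ B}

/-- Perfect A-stability: the region of absolute stability is precisely the left half-plane, the
open one for decaying and the closed one for bounded numerical solutions. -/
def PerfectlyAStable {s : ℕ} (c : Fin s → ℝ) : Prop :=
  stabilityRegion c = {q : ℂ | q.re < 0} ∧ weakStabilityRegion c = {q : ℂ | q.re ≤ 0}

end HBVM

end

namespace HBVM

open Polynomial MeasureTheory

/-! Write P_j for `orthoLegendre j` (degree j), Π for the L² projection on [0,1] onto polynomials of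
degree below s, and σ for the stage polynomial in the scaled variable τ. The stage equations say
that σ equals y₀ plus h times the primitive of Π f(σ) at the abscissae. Both sides have degree at
most s and agree at 0 as well, so they coincide: σ' = h Π f(σ), σ(0) = y₀. The abscissae only
parametrize σ, so every conclusion is independent of them (`stagePoly_eq`, `IsStages.hasDerivAt`).

Order 2s. The defect R = f(σ) - Π f(σ) is orthogonal to polynomials of degree below s. Comparison
with the exact flow η gives an error e = η(h·) - σ of size h^(s+1) and R of size h^s
(`exists_norm_error_le`). If Φ solves the adjoint variational equation along η, then (Φ e)' = h Φ (R
- N), where N is quadratic in e. Replacing Φ by its Taylor polynomial of degree below s annihilates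
the integral against R, which leaves h · h^s · h^s (`exists_norm_end_error_le`). Only f of class
C^(2s) is needed, not the Hamiltonian structure.

Not order 2s+1. The harmonic oscillator is y' = -iy on ℂ. For imaginary q, σ' = q(σ - β P_s) with β
the coefficient of σ along P_s, and variation of constants gives an error of modulus |q| |β| |∫ P_s
e^(-qx)|. Each of the last two factors is at least a multiple of |q|^s
(`exists_le_norm_error_test`).

Perfect A-stability. Integrating the derivative of |σ|² gives |y₁|² = |y₀|² + 2 Re q ‖Πσ‖², with Πσ
≠ 0 when y₀ ≠ 0 (`IsStages.norm_sq_test`). So the stability function has modulus below, equal to or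
above 1 according to the sign of Re q. Solvability for Re q ≤ 0 is a second energy argument
(`IsStages.eq_zero_of_re_nonpos`). -/

/-! ### Legendre polynomials: Rodrigues' formula, orthonormality, spanning. -/

theorem integral_eval_derivative (p : ℝ[X]) :
    ∫ x in (0 : ℝ)..1, (derivative p).eval x = p.eval 1 - p.eval 0 :=
  intervalIntegral.integral_eq_sub_of_hasDerivAt (fun x _ => p.hasDerivAt x)
    (derivative p).continuous.continuousOn.intervalIntegrable

theorem intervalIntegrable_eval (p : ℝ[X]) (a b : ℝ) :
    IntervalIntegrable (fun x => p.eval x) volume a b :=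
  p.continuous.intervalIntegrable a b

/-- Repeated integration by parts on `[0,1]` against a polynomial that vanishes to order `k` at
both end points. -/
theorem integral_iterate_derivative_mul (F : ℝ[X]) (k : ℕ) :
    (∀ i < k, (derivative^[i] F).eval 0 = 0 ∧ (derivative^[i] F).eval 1 = 0) → ∀ p : ℝ[X],
    ∫ x in (0 : ℝ)..1, (derivative^[k] F * p).eval x =
      (-1) ^ k * ∫ x in (0 : ℝ)..1, (F * derivative^[k] p).eval x := by
  induction k with
  | zero => intro _ p; simp
  | succ k ih =>
    intro hF p
    have h1 := integral_eval_derivative (derivative^[k] F * p)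
    have h2 := ih (fun i hi => hF i (by omega)) (derivative p)
    rw [derivative_mul, ← Function.iterate_succ_apply' derivative] at h1
    simp only [eval_add] at h1
    rw [intervalIntegral.integral_add (intervalIntegrable_eval _ _ _)
      (intervalIntegrable_eval _ _ _), h2] at h1
    simp only [eval_mul, (hF k (by omega)).1, (hF k (by omega)).2] at h1
    rw [Function.iterate_succ_apply derivative k p, pow_succ]
    simp only [eval_mul]
    linarith

/-- The shifted Legendre polynomial with real coefficients. -/
noncomputable def realLegendre (n : ℕ) : ℝ[X] := (shiftedLegendre n).map (Int.castRingHom ℝ)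

theorem orthoLegendre_eq (n : ℕ) :
    orthoLegendre n = C ((-1) ^ n * Real.sqrt (2 * n + 1)) * realLegendre n := rfl

theorem factorial_mul_realLegendre (n : ℕ) :
    C (n.factorial : ℝ) * realLegendre n = derivative^[n] (X ^ n * (1 - X) ^ n) := by
  have h := congrArg (Polynomial.map (Int.castRingHom ℝ)) (factorial_mul_shiftedLegendre_eq n)
  rw [← iterate_derivative_map] at h
  simpa [realLegendre] using h

theorem natDegree_realLegendre (n : ℕ) : (realLegendre n).natDegree = n := by
  rw [realLegendre, natDegree_map_eq_of_injective (RingHom.injective_int _),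
    natDegree_shiftedLegendre]

/-- By Rodrigues' formula the Legendre polynomial is, up to n!, the n-th derivative of X^n (1-X)^n.
That product vanishes to order n at both ends, so all n derivatives move onto `p` and kill it. -/
theorem integral_realLegendre_mul_eq_zero {n : ℕ} {p : ℝ[X]} (hp : p.degree < n) :
    ∫ x in (0 : ℝ)..1, (realLegendre n * p).eval x = 0 := by
  have hv : ∀ i < n, (derivative^[i] ((X : ℝ[X]) ^ n * (1 - X) ^ n)).eval 0 = 0 ∧
      (derivative^[i] ((X : ℝ[X]) ^ n * (1 - X) ^ n)).eval 1 = 0 := by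
    intro i hi
    constructor
    · have h : (X : ℝ[X]) ^ (n - i) ∣ _ :=
        pow_sub_dvd_iterate_derivative_of_pow_dvd i (Dvd.intro ((1 - X : ℝ[X]) ^ n) rfl)
      refine eval_eq_zero_of_dvd_of_eval_eq_zero h ?_
      simp; omega
    · have h : (1 - X : ℝ[X]) ^ (n - i) ∣ _ :=
        pow_sub_dvd_iterate_derivative_of_pow_dvd i (Dvd.intro_left ((X : ℝ[X]) ^ n) rfl)
      refine eval_eq_zero_of_dvd_of_eval_eq_zero h ?_
      simp; omega
  have h := integral_iterate_derivative_mul _ n hv p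
  rw [iterate_derivative_eq_zero_of_degree_lt hp, ← factorial_mul_realLegendre] at h
  simp only [mul_assoc, eval_C_mul, mul_zero, eval_zero, intervalIntegral.integral_zero,
    intervalIntegral.integral_const_mul] at h
  exact (mul_eq_zero.1 h).resolve_left (by positivity)

theorem realLegendre_eval_one_sq (n : ℕ) : (realLegendre n).eval 1 ^ 2 = 1 := by
  have h := shiftedLegendre_eval_symm n (1 : ℝ)
  have h0 : aeval (0 : ℝ) (shiftedLegendre n) = 1 := by
    rw [← coeff_zero_eq_aeval_zero', coeff_shiftedLegendre]; simp
  have h1 : (realLegendre n).eval 1 = aeval (1 : ℝ) (shiftedLegendre n) := by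
    rw [realLegendre, eval_map, aeval_def]; rfl
  rw [h1, h, sub_self, h0, mul_one, ← pow_mul, mul_comm, pow_mul]; simp

/-- Integrate (X R²)' = (2n+1) R² + 2R(XR' - nR) over [0,1]. The leading terms of XR' and nR cancel,
so orthogonality removes the last term, and R(1)² = 1 evaluates the left side. -/
theorem integral_realLegendre_sq (n : ℕ) :
    (2 * n + 1) * ∫ x in (0 : ℝ)..1, (realLegendre n * realLegendre n).eval x = 1 := by
  set R := realLegendre n with hR
  have hd : (X * derivative R - C (n : ℝ) * R).degree < (n : WithBot ℕ) := by
    rw [degree_lt_iff_coeff_zero]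
    intro m hm
    rcases m with _ | m
    · simp; left; omega
    · rw [coeff_sub, coeff_X_mul, coeff_derivative, coeff_C_mul]
      rcases hm.eq_or_lt with h | h
      · rw [h]; push_cast; ring
      · rw [coeff_eq_zero_of_natDegree_lt (by rw [hR, natDegree_realLegendre]; exact h)]; ring
  have h0 := integral_realLegendre_mul_eq_zero hd
  have h1 := integral_eval_derivative (X * (R * R))
  have e : derivative (X * (R * R)) =
      C (2 * (n : ℝ) + 1) * (R * R) + C 2 * (R * (X * derivative R - C (n : ℝ) * R)) := by
    rw [derivative_mul, derivative_mul, derivative_X]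
    simp only [map_add, map_mul, map_one]
    have : (C (2 : ℝ)) = 2 := rfl
    rw [this]; ring
  rw [e] at h1
  simp only [eval_add] at h1
  rw [intervalIntegral.integral_add (intervalIntegrable_eval _ _ _)
      (intervalIntegrable_eval _ _ _)] at h1
  simp only [eval_C_mul, intervalIntegral.integral_const_mul] at h1
  rw [h0] at h1
  have h2 := realLegendre_eval_one_sq n
  rw [← hR] at h2
  simp only [eval_mul, eval_X] at h1 ⊢
  linarith

theorem natDegree_orthoLegendre (n : ℕ) : (orthoLegendre n).natDegree = n := by
  rw [orthoLegendre_eq, natDegree_C_mul, natDegree_realLegendre]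
  have : Real.sqrt (2 * n + 1) ≠ 0 := (Real.sqrt_pos.2 (by positivity)).ne'
  simp [this]

theorem integral_orthoLegendre_mul_eq_zero {n : ℕ} {p : ℝ[X]} (hp : p.degree < n) :
    ∫ x in (0 : ℝ)..1, (orthoLegendre n).eval x * p.eval x = 0 := by
  have := integral_realLegendre_mul_eq_zero hp
  simp only [eval_mul] at this
  simp only [orthoLegendre_eq, eval_mul, eval_C, mul_assoc, intervalIntegral.integral_const_mul,
    this, mul_zero]

theorem integral_orthoLegendre_sq (n : ℕ) :
    ∫ x in (0 : ℝ)..1, (orthoLegendre n).eval x * (orthoLegendre n).eval x = 1 := by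
  have h := integral_realLegendre_sq n
  have h2 : ((-1) ^ n * Real.sqrt (2 * n + 1)) ^ 2 = 2 * (n : ℝ) + 1 := by
    rw [mul_pow, Real.sq_sqrt (by positivity), ← pow_mul, mul_comm n, pow_mul]; simp
  have e : ∀ x : ℝ, (orthoLegendre n).eval x * (orthoLegendre n).eval x =
      (2 * (n : ℝ) + 1) * (realLegendre n * realLegendre n).eval x := by
    intro x
    rw [orthoLegendre_eq, eval_C_mul, eval_mul]; linear_combination
      (eval x (realLegendre n)) ^ 2 * h2
  simp only [e, intervalIntegral.integral_const_mul, h]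

theorem integral_orthoLegendre_mul (i j : ℕ) :
    ∫ x in (0 : ℝ)..1, (orthoLegendre i).eval x * (orthoLegendre j).eval x =
      if i = j then 1 else 0 := by
  have hdeg : ∀ {a b : ℕ}, a < b → (orthoLegendre a).degree < (b : ℕ) := fun {a b} h =>
    degree_le_natDegree.trans_lt (by rw [natDegree_orthoLegendre]; exact_mod_cast h)
  rcases lt_trichotomy i j with h | h | h
  · rw [if_neg h.ne]
    simpa only [mul_comm] using integral_orthoLegendre_mul_eq_zero (hdeg h)
  · rw [h, if_pos rfl, integral_orthoLegendre_sq]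
  · rw [if_neg h.ne', integral_orthoLegendre_mul_eq_zero (hdeg h)]

theorem exists_eq_sum_orthoLegendre (s : ℕ) :
    ∀ p : ℝ[X], p.degree < s → ∃ a : Fin s → ℝ, p = ∑ j : Fin s, C (a j) * orthoLegendre j := by
  induction s with
  | zero =>
    intro p hp
    refine ⟨fun _ => 0, ?_⟩
    simpa using hp
  | succ s ih =>
    intro p hp
    have hl : (orthoLegendre s).coeff s ≠ 0 := by
      have h := natDegree_orthoLegendre s
      have h0 : orthoLegendre s ≠ 0 := by
        intro h0
        have := integral_orthoLegendre_sq s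
        simp [h0] at this
      conv in coeff _ _ => rw [← h]
      rw [h]
      have := leadingCoeff_ne_zero.2 h0
      rwa [leadingCoeff, h] at this
    obtain ⟨a, ha⟩ := ih (p - C (p.coeff s / (orthoLegendre s).coeff s) * orthoLegendre s) (by
      rw [degree_lt_iff_coeff_zero] at hp ⊢
      intro m hm
      rw [coeff_sub, coeff_C_mul]
      rcases hm.eq_or_lt with rfl | h
      · field_simp; ring
      · rw [hp m (by omega), coeff_eq_zero_of_natDegree_lt ((natDegree_orthoLegendre s).trans_lt h)]; ring)
    refine ⟨Fin.snoc a (p.coeff s / (orthoLegendre s).coeff s), ?_⟩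
    rw [Fin.sum_univ_castSucc]
    simp only [Fin.snoc_castSucc, Fin.snoc_last, Fin.val_castSucc, Fin.val_last]
    rw [← ha]; ring

/-! ### The Legendre projection of vector-valued functions. -/

section projection

variable {E : Type*} [NormedAddCommGroup E] [NormedSpace ℝ E]

theorem continuousOn_eval_smul {w : ℝ → E} (hw : ContinuousOn w (Set.uIcc 0 1)) (p : ℝ[X]) :
    ContinuousOn (fun x => p.eval x • w x) (Set.uIcc 0 1) :=
  p.continuous.continuousOn.smul hw

/-- The defect of the Legendre projection is orthogonal to all polynomials of degree `< s`. -/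
theorem integral_smul_sub_projection [CompleteSpace E] {s : ℕ} {w : ℝ → E} (hw : ContinuousOn w (Set.uIcc 0 1))
    {p : ℝ[X]} (hp : p.degree < s) :
    ∫ x in (0 : ℝ)..1, p.eval x • (w x - ∑ j : Fin s, (orthoLegendre j).eval x •
      ∫ t in (0 : ℝ)..1, (orthoLegendre j).eval t • w t) = 0 := by
  obtain ⟨a, rfl⟩ := exists_eq_sum_orthoLegendre s p hp
  set γ : Fin s → E := fun j => ∫ t in (0 : ℝ)..1, (orthoLegendre j).eval t • w t with hγ
  have hr : ContinuousOn (fun x => w x - ∑ j : Fin s, (orthoLegendre j).eval x • γ j)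
      (Set.uIcc 0 1) :=
    hw.sub (Continuous.continuousOn (continuous_finsetSum _ fun j _ =>
      (orthoLegendre j).continuous.smul continuous_const))
  have key : ∀ i : Fin s, ∫ x in (0 : ℝ)..1, (orthoLegendre i).eval x •
      (w x - ∑ j : Fin s, (orthoLegendre j).eval x • γ j) = 0 := by
    intro i
    simp only [smul_sub, Finset.smul_sum, smul_smul]
    rw [intervalIntegral.integral_sub (continuousOn_eval_smul hw _).intervalIntegrable,
      intervalIntegral.integral_finsetSum]
    · simp only [intervalIntegral.integral_smul_const, integral_orthoLegendre_mul, Fin.val_inj,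
        ite_smul, one_smul, zero_smul, Finset.sum_ite_eq, Finset.mem_univ, if_true]
      simp [hγ]
    · intro j _
      exact (((orthoLegendre i).continuous.mul (orthoLegendre j).continuous).smul
        continuous_const).intervalIntegrable _ _
    · refine Continuous.intervalIntegrable (continuous_finsetSum _ fun j _ => ?_) _ _
      exact ((orthoLegendre i).continuous.mul (orthoLegendre j).continuous).smul continuous_const
  simp only [eval_finsetSum, eval_mul, eval_C, Finset.sum_smul, mul_smul]
  rw [intervalIntegral.integral_finsetSum]
  · simp only [intervalIntegral.integral_smul]
    refine Finset.sum_eq_zero fun i _ => ?_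
    have := key i
    simp only [hγ] at this
    rw [this, smul_zero]
  · intro i _
    exact ((continuousOn_eval_smul hr _).const_smul _).intervalIntegrable

theorem sum_orthoLegendre_projection {s : ℕ} {p : ℝ[X]} (hp : p.degree < s) (x : ℝ) :
    ∑ j : Fin s, (orthoLegendre j).eval x *
      ∫ t in (0 : ℝ)..1, (orthoLegendre j).eval t * p.eval t = p.eval x := by
  obtain ⟨a, rfl⟩ := exists_eq_sum_orthoLegendre s p hp
  simp only [eval_finsetSum, eval_mul, eval_C]
  refine Finset.sum_congr rfl fun j _ => ?_
  simp only [Finset.mul_sum]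
  rw [intervalIntegral.integral_finsetSum]
  · simp only [mul_left_comm, intervalIntegral.integral_const_mul, integral_orthoLegendre_mul]
    simp [Fin.val_inj, mul_comm]
  · intro i _
    exact ((orthoLegendre j).continuous.mul
      (continuous_const.mul (orthoLegendre i).continuous)).intervalIntegrable _ _

/-- The Legendre projection reproduces vector polynomials of degree `< s`. -/
theorem projection_polynomial [CompleteSpace E] {s : ℕ} (a : ℕ → E) (x : ℝ) :
    ∑ j : Fin s, (orthoLegendre j).eval x •
      ∫ t in (0 : ℝ)..1, (orthoLegendre j).eval t • ∑ i ∈ Finset.range s, t ^ i • a i =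
      ∑ i ∈ Finset.range s, x ^ i • a i := by
  have h : ∀ j : Fin s, ∫ t in (0 : ℝ)..1, (orthoLegendre j).eval t •
      ∑ i ∈ Finset.range s, t ^ i • a i = ∑ i ∈ Finset.range s,
        (∫ t in (0 : ℝ)..1, (orthoLegendre j).eval t * (X ^ i : ℝ[X]).eval t) • a i := by
    intro j
    simp only [Finset.smul_sum, smul_smul]
    rw [intervalIntegral.integral_finsetSum]
    · simp [intervalIntegral.integral_smul_const]
    · intro i _
      exact (((orthoLegendre j).continuous.mul (continuous_pow i)).smul
        continuous_const).intervalIntegrable _ _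
  rw [Finset.sum_congr rfl fun j _ => by rw [h j]]
  simp only [Finset.smul_sum, smul_smul]
  rw [Finset.sum_comm]
  refine Finset.sum_congr rfl fun i hi => ?_
  rw [← Finset.sum_smul, sum_orthoLegendre_projection]
  · simp
  · rw [degree_X_pow]; exact_mod_cast Finset.mem_range.1 hi

end projection

/-! ### Primitives of the Legendre polynomials. -/

/-- The quotient by `X` of the primitive of `p` that vanishes at `0`. -/
noncomputable def primitiveDivX (p : ℝ[X]) : ℝ[X] :=
  ∑ i ∈ Finset.range (p.natDegree + 1), C (p.coeff i / (i + 1)) * X ^ i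

theorem derivative_X_mul_primitiveDivX (p : ℝ[X]) : derivative (X * primitiveDivX p) = p := by
  conv_rhs => rw [p.as_sum_range_C_mul_X_pow]
  rw [primitiveDivX, Finset.mul_sum, derivative_sum]
  refine Finset.sum_congr rfl fun i _ => ?_
  have : (X : ℝ[X]) * (C (p.coeff i / (i + 1)) * X ^ i) = C (p.coeff i / (i + 1)) * X ^ (i + 1) := by
    ring
  rw [this, derivative_C_mul_X_pow]
  congr 2
  have : (i : ℝ) + 1 ≠ 0 := by positivity
  push_cast; field_simp

theorem natDegree_primitiveDivX_le (p : ℝ[X]) : (primitiveDivX p).natDegree ≤ p.natDegree := by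
  refine natDegree_sum_le_of_forall_le _ _ fun i hi => ?_
  exact (natDegree_C_mul_X_pow_le _ _).trans (Nat.lt_succ_iff.1 (Finset.mem_range.1 hi))

theorem integral_orthoLegendre (j : ℕ) (τ : ℝ) :
    ∫ x in (0 : ℝ)..τ, (orthoLegendre j).eval x =
      (X * primitiveDivX (orthoLegendre j)).eval τ := by
  have h := intervalIntegral.integral_eq_sub_of_hasDerivAt (a := 0) (b := τ)
    (fun x _ => (X * primitiveDivX (orthoLegendre j)).hasDerivAt x)
    ((derivative _).continuous.intervalIntegrable _ _)
  rw [derivative_X_mul_primitiveDivX] at h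
  rw [h]; simp

theorem hasDerivAt_integral_orthoLegendre (j : ℕ) (τ : ℝ) :
    HasDerivAt (fun t : ℝ => ∫ x in (0 : ℝ)..t, (orthoLegendre j).eval x)
      ((orthoLegendre j).eval τ) τ := by
  have h := (X * primitiveDivX (orthoLegendre j)).hasDerivAt τ
  rw [derivative_X_mul_primitiveDivX] at h
  simpa only [integral_orthoLegendre] using h

theorem degree_primitive_orthoLegendre_lt {s : ℕ} (j : Fin s) :
    (X * primitiveDivX (orthoLegendre j)).degree < ((s + 1 : ℕ) : WithBot ℕ) := by
  refine degree_le_natDegree.trans_lt ?_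
  have h1 := natDegree_primitiveDivX_le (orthoLegendre j)
  rw [natDegree_orthoLegendre] at h1
  have h2 := natDegree_mul_le (p := X) (q := primitiveDivX (orthoLegendre j))
  rw [natDegree_X] at h2
  have := j.2
  exact_mod_cast (by omega : (X * primitiveDivX (orthoLegendre j)).natDegree < s + 1)

/-! ### The stage polynomial and its differential equation. -/

section nodes

variable {s : ℕ} {c : Fin s → ℝ}

theorem injective_cons_zero (hc : Function.Injective c) (hc0 : ∀ i, c i ≠ 0) :
    Function.Injective (Fin.cons 0 c : Fin (s + 1) → ℝ) :=
  Fin.cons_injective_iff.2 ⟨fun ⟨i, hi⟩ => hc0 i hi, hc⟩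

theorem sum_basis_mul_eval (hc : Function.Injective c) (hc0 : ∀ i, c i ≠ 0) {p : ℝ[X]}
    (hp : p.degree < ((s + 1 : ℕ) : WithBot ℕ)) (τ : ℝ) :
    ∑ i : Fin (s + 1), (Lagrange.basis Finset.univ (Fin.cons 0 c : Fin (s + 1) → ℝ) i).eval τ *
      p.eval ((Fin.cons 0 c : Fin (s + 1) → ℝ) i) = p.eval τ := by
  have h := Lagrange.eq_interpolate (s := Finset.univ) (v := (Fin.cons 0 c : Fin (s + 1) → ℝ))
    (injective_cons_zero hc hc0).injOn (f := p) (by simpa using hp)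
  conv_rhs => rw [h]
  simp [Lagrange.interpolate_apply, eval_finsetSum, mul_comm]

variable {E : Type*} [NormedAddCommGroup E] [NormedSpace ℝ E]

/-- The right-hand side has degree at most s in τ and takes the interpolated values at 0 and at the
`c i`; Lagrange interpolation on s+1 distinct nodes reproduces it. Here the abscissae drop out. -/
theorem stagePoly_eq (hc : Function.Injective c) (hc0 : ∀ i, c i ≠ 0) {y₀ : E} {Y γ : Fin s → E}
    (hY : ∀ i, Y i = y₀ + ∑ j : Fin s, (∫ x in (0 : ℝ)..(c i), (orthoLegendre j).eval x) • γ j)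
    (τ : ℝ) :
    stagePoly c y₀ Y τ =
      y₀ + ∑ j : Fin s, (∫ x in (0 : ℝ)..τ, (orthoLegendre j).eval x) • γ j := by
  have hv : ∀ i, (Fin.cons y₀ Y : Fin (s + 1) → E) i = y₀ + ∑ j : Fin s,
      ((X * primitiveDivX (orthoLegendre j)).eval ((Fin.cons 0 c : Fin (s + 1) → ℝ) i)) • γ j := by
    intro i
    refine Fin.cases ?_ (fun i => ?_) i
    · simp
    · rw [Fin.cons_succ, Fin.cons_succ, hY]; simp only [integral_orthoLegendre]
  simp only [stagePoly, hv, smul_add, Finset.sum_add_distrib, Finset.smul_sum, smul_smul]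
  rw [← Finset.sum_smul, Finset.sum_comm]
  simp only [← Finset.sum_smul, integral_orthoLegendre]
  congr 1
  · have h := sum_basis_mul_eval hc hc0 (p := 1) (by
      rw [degree_one]; exact_mod_cast Nat.succ_pos s) τ
    simp only [eval_one, mul_one] at h
    rw [h, one_smul]
  · refine Finset.sum_congr rfl fun j _ => ?_
    rw [sum_basis_mul_eval hc hc0 (degree_primitive_orthoLegendre_lt j)]

theorem stagePoly_zero (hc0 : ∀ i, c i ≠ 0) (hc : Function.Injective c) (y₀ : E) (Y : Fin s → E) :
    stagePoly c y₀ Y 0 = y₀ := by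
  have hi := injective_cons_zero hc hc0
  rw [stagePoly, Finset.sum_eq_single 0]
  · have h := Lagrange.eval_basis_self (s := Finset.univ) hi.injOn (Finset.mem_univ 0)
    rw [Fin.cons_zero] at h
    rw [h, Fin.cons_zero, one_smul]
  · intro b _ hb
    have h := Lagrange.eval_basis_of_ne (v := (Fin.cons 0 c : Fin (s + 1) → ℝ)) hb
      (Finset.mem_univ 0)
    rw [Fin.cons_zero] at h
    rw [h, zero_smul]
  · simp

theorem continuous_stagePoly (c : Fin s → ℝ) (y₀ : E) (Y : Fin s → E) :
    Continuous (stagePoly c y₀ Y) :=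
  continuous_finsetSum _ fun _ _ => (Polynomial.continuous _).smul continuous_const

theorem stagePoly_map {F : Type*} [NormedAddCommGroup F] [NormedSpace ℝ F] (φ : E →ₗ[ℝ] F)
    (y₀ : E) (Y : Fin s → E) (τ : ℝ) :
    stagePoly c (φ y₀) (fun i => φ (Y i)) τ = φ (stagePoly c y₀ Y τ) := by
  simp only [stagePoly, map_sum, map_smul]
  refine Finset.sum_congr rfl fun i _ => ?_
  refine Fin.cases ?_ (fun i => ?_) i <;> simp

theorem stagePoly_add (y₀ y₁ : E) (Y Z : Fin s → E) (τ : ℝ) :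
    stagePoly c (y₀ + y₁) (fun i => Y i + Z i) τ = stagePoly c y₀ Y τ + stagePoly c y₁ Z τ := by
  simp only [stagePoly, ← Finset.sum_add_distrib, ← smul_add]
  refine Finset.sum_congr rfl fun i _ => ?_
  refine Fin.cases ?_ (fun i => ?_) i <;> simp

theorem stagePoly_sub_stagePoly (y₀ : E) (Y Z : Fin s → E) (τ : ℝ) :
    stagePoly c y₀ Y τ - stagePoly c y₀ Z τ = ∑ i : Fin s,
      (Lagrange.basis Finset.univ (Fin.cons 0 c : Fin (s + 1) → ℝ) i.succ).eval τ •
        (Y i - Z i) := by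
  simp only [stagePoly, Fin.sum_univ_succ, Fin.cons_zero, Fin.cons_succ, smul_sub,
    Finset.sum_sub_distrib]
  abel

theorem stagePoly_const (hc : Function.Injective c) (hc0 : ∀ i, c i ≠ 0) (y₀ : E) (τ : ℝ) :
    stagePoly c y₀ (fun _ => y₀) τ = y₀ := by
  rw [stagePoly_eq hc hc0 (γ := fun _ => 0) (by simp)]; simp

/-- `Λ` is a Lebesgue constant: a bound for the sum of the absolute values of the Lagrange basis at
the nonzero nodes. -/
theorem exists_norm_stagePoly_sub_le (c : Fin s → ℝ) (E : Type*) [NormedAddCommGroup E]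
    [NormedSpace ℝ E] : ∃ Λ : ℝ, 1 ≤ Λ ∧ ∀ (y₀ : E) (Y Z : Fin s → E), ∀ τ ∈ Set.Icc (0 : ℝ) 1,
      ‖stagePoly c y₀ Y τ - stagePoly c y₀ Z τ‖ ≤ Λ * ‖Y - Z‖ := by
  have hcont : Continuous fun τ : ℝ => ∑ i : Fin s,
      |(Lagrange.basis Finset.univ (Fin.cons 0 c : Fin (s + 1) → ℝ) i.succ).eval τ| :=
    continuous_finsetSum _ fun _ _ => (Polynomial.continuous _).abs
  obtain ⟨Λ, hΛ⟩ := (isCompact_Icc (a := (0 : ℝ)) (b := 1)).exists_bound_of_continuousOn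
    hcont.continuousOn
  refine ⟨max Λ 1, le_max_right _ _, fun y₀ Y Z τ hτ => ?_⟩
  rw [stagePoly_sub_stagePoly]
  calc _ ≤ ∑ i : Fin s, |(Lagrange.basis Finset.univ (Fin.cons 0 c : Fin (s + 1) → ℝ)
        i.succ).eval τ| * ‖Y - Z‖ := by
        refine norm_sum_le_of_le _ fun i _ => ?_
        rw [norm_smul, Real.norm_eq_abs]
        exact mul_le_mul_of_nonneg_left (norm_le_pi_norm (Y - Z) i) (abs_nonneg _)
    _ ≤ _ := by
        rw [← Finset.sum_mul]
        refine mul_le_mul_of_nonneg_right ?_ (norm_nonneg _)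
        exact (le_abs_self _).trans ((hΛ τ hτ).trans (le_max_left _ _))

theorem IsStages.stagePoly_eq {f : E → E} {h : ℝ} {y₀ : E} {Y : Fin s → E}
    (hc : Function.Injective c) (hc0 : ∀ i, c i ≠ 0) (hY : IsStages c f h y₀ Y) (τ : ℝ) :
    stagePoly c y₀ Y τ = y₀ + h • ∑ j : Fin s, (∫ x in (0 : ℝ)..τ, (orthoLegendre j).eval x) •
      ∫ t in (0 : ℝ)..1, (orthoLegendre j).eval t • f (stagePoly c y₀ Y t) := by
  rw [HBVM.stagePoly_eq hc hc0 (γ := fun j => h • ∫ t in (0 : ℝ)..1,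
    (orthoLegendre j).eval t • f (stagePoly c y₀ Y t))]
  · simp only [Finset.smul_sum, smul_comm h]
  · intro i
    conv_lhs => rw [hY i]
    simp only [Finset.smul_sum, smul_comm h]

/-- This is σ' = h Π f(σ), the form of the method from which all error and energy estimates start.
-/
theorem IsStages.hasDerivAt {f : E → E} {h : ℝ} {y₀ : E} {Y : Fin s → E}
    (hc : Function.Injective c) (hc0 : ∀ i, c i ≠ 0) (hY : IsStages c f h y₀ Y) (τ : ℝ) :
    HasDerivAt (stagePoly c y₀ Y) (h • ∑ j : Fin s, (orthoLegendre j).eval τ •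
      ∫ t in (0 : ℝ)..1, (orthoLegendre j).eval t • f (stagePoly c y₀ Y t)) τ := by
  refine HasDerivAt.congr_of_eventuallyEq ?_
    (Filter.Eventually.of_forall (hY.stagePoly_eq hc hc0))
  exact ((HasDerivAt.fun_sum fun (j : Fin s) _ =>
    (hasDerivAt_integral_orthoLegendre (j : ℕ) τ).smul_const _).fun_const_smul h).const_add y₀

end nodes

/-! ### Linear problems: transport along linear maps, unique solvability. -/

section linear

variable {s : ℕ} {c : Fin s → ℝ}
variable {E : Type*} [NormedAddCommGroup E] [NormedSpace ℝ E]

theorem IsStages.map [CompleteSpace E] {F : Type*} [NormedAddCommGroup F] [NormedSpace ℝ F]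
    [CompleteSpace F] (φ : E →L[ℝ] F) {f : E → E} {g : F → F} (hf : Continuous f)
    (hfg : ∀ x, φ (f x) = g (φ x)) {h : ℝ} {y₀ : E} {Y : Fin s → E} (hY : IsStages c f h y₀ Y) :
    IsStages c g h (φ y₀) (fun i => φ (Y i)) := by
  intro i
  have hs : ∀ τ, stagePoly c (φ y₀) (fun i => φ (Y i)) τ = φ (stagePoly c y₀ Y τ) :=
    stagePoly_map φ.toLinearMap y₀ Y
  change φ (Y i) = _
  conv_lhs => rw [hY i]
  simp only [map_add, map_smul, map_sum]
  congr 2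
  refine Finset.sum_congr rfl fun j _ => ?_
  congr 1
  rw [← φ.intervalIntegral_comp_comm]
  · simp only [map_smul, hfg, hs]
  · exact ((orthoLegendre j).continuous.smul
      (hf.comp (continuous_stagePoly c y₀ Y))).intervalIntegrable _ _

/-- The stage equations are affine in `Y`, with a linear part `T` that does not involve `y₀`. In
finite dimension, injectivity of `T`, which is the case y₀ = 0, gives bijectivity. -/
theorem existsUnique_isStages_of_forall_eq_zero [FiniteDimensional ℝ E] (A : E →L[ℝ] E) {h : ℝ}
    (hA : ∀ Y : Fin s → E, IsStages c A h 0 Y → Y = 0) (y₀ : E) :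
    ∃! Y : Fin s → E, IsStages c A h y₀ Y := by
  have : CompleteSpace E := FiniteDimensional.complete ℝ E
  have hi : ∀ (y : E) (W : Fin s → E) (j : Fin s), IntervalIntegrable
      (fun t => (orthoLegendre j).eval t • A (stagePoly c y W t)) volume 0 1 := fun y W j =>
    ((orthoLegendre j).continuous.smul
      (A.continuous.comp (continuous_stagePoly c y W))).intervalIntegrable _ _
  let T : (Fin s → E) →ₗ[ℝ] (Fin s → E) :=
    { toFun := fun Y i => Y i - h • ∑ j : Fin s,
        (∫ x in (0 : ℝ)..(c i), (orthoLegendre j).eval x) •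
          ∫ τ in (0 : ℝ)..1, (orthoLegendre j).eval τ • A (stagePoly c 0 Y τ)
      map_add' := fun Y Z => by
        have hs : ∀ τ, stagePoly c 0 (Y + Z) τ = stagePoly c 0 Y τ + stagePoly c 0 Z τ := by
          intro τ
          rw [← stagePoly_add, add_zero]; rfl
        funext i
        simp only [hs, map_add, smul_add, intervalIntegral.integral_add (hi _ _ _) (hi _ _ _),
          Finset.sum_add_distrib, Pi.add_apply]
        abel
      map_smul' := fun a Y => by
        have hs : ∀ τ, stagePoly c 0 (a • Y) τ = a • stagePoly c 0 Y τ := by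
          intro τ
          have := stagePoly_map (c := c) (LinearMap.lsmul ℝ E a) 0 Y τ
          rw [map_zero] at this
          exact this
        funext i
        simp only [hs, map_smul, smul_comm _ a, intervalIntegral.integral_smul, RingHom.id_apply,
          Pi.smul_apply, smul_sub, ← Finset.smul_sum] }
  have hT : ∀ y Y, IsStages c A h y Y ↔ T Y = fun i => y + h • ∑ j : Fin s,
      (∫ x in (0 : ℝ)..(c i), (orthoLegendre j).eval x) •
          ∫ τ in (0 : ℝ)..1, (orthoLegendre j).eval τ • A (stagePoly c y 0 τ) := by
    intro y Y
    have hs : ∀ τ, stagePoly c y Y τ = stagePoly c y 0 τ + stagePoly c 0 Y τ := by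
      intro τ
      rw [← stagePoly_add, add_zero]; simp
    simp only [IsStages, funext_iff, T, LinearMap.coe_mk, AddHom.coe_mk, hs, map_add, smul_add,
      intervalIntegral.integral_add (hi _ _ _) (hi _ _ _), Finset.sum_add_distrib]
    refine forall_congr' fun i => ?_
    rw [sub_eq_iff_eq_add, add_assoc]
  have hinj : Function.Injective T := by
    rw [← LinearMap.ker_eq_bot, LinearMap.ker_eq_bot']
    intro Y hY
    refine hA Y ((hT 0 Y).2 ?_)
    have hs : ∀ τ, stagePoly c (0 : E) (0 : Fin s → E) τ = 0 := fun τ => by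
      have := stagePoly_map (c := c) (0 : E →ₗ[ℝ] E) 0 0 τ
      simp only [LinearMap.zero_apply] at this
      exact this
    rw [hY]; funext i; simp [hs]
  obtain ⟨Y, hY⟩ := LinearMap.injective_iff_surjective.1 hinj (fun i => y₀ + h • ∑ j : Fin s,
      (∫ x in (0 : ℝ)..(c i), (orthoLegendre j).eval x) •
          ∫ τ in (0 : ℝ)..1, (orthoLegendre j).eval τ • A (stagePoly c y₀ 0 τ))
  exact ⟨Y, (hT _ _).2 hY, fun Z hZ => hinj (((hT _ _).1 hZ).trans hY.symm)⟩

end linear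

/-! ### The test equation and perfect A-stability. -/

section test

variable {s : ℕ} {c : Fin s → ℝ} {μ q : ℂ} {h : ℝ}

/-- The Legendre coefficients of the stage polynomial. -/
noncomputable def stageCoeff (c : Fin s → ℝ) (y₀ : ℂ) (Y : Fin s → ℂ) (j : ℕ) : ℂ :=
  ∫ t in (0 : ℝ)..1, (orthoLegendre j).eval t • stagePoly c y₀ Y t

theorem integral_smul_mul_stagePoly (μ : ℂ) (y₀ : ℂ) (Y : Fin s → ℂ) (j : ℕ) :
    ∫ t in (0 : ℝ)..1, (orthoLegendre j).eval t • (μ * stagePoly c y₀ Y t) =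
      μ * stageCoeff c y₀ Y j := by
  simp only [← mul_smul_comm, intervalIntegral.integral_const_mul, stageCoeff]

theorem IsStages.stagePoly_test (hc : Function.Injective c) (hc0 : ∀ i, c i ≠ 0)
    (hq : (h : ℂ) * μ = q) {y₀ : ℂ} {Y : Fin s → ℂ} (hY : IsStages c (fun y => μ * y) h y₀ Y)
    (τ : ℝ) : stagePoly c y₀ Y τ = y₀ + ∑ j : Fin s,
      (∫ x in (0 : ℝ)..τ, (orthoLegendre j).eval x) • (q * stageCoeff c y₀ Y j) := by
  rw [hY.stagePoly_eq hc hc0, Finset.smul_sum, ← hq]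
  congr 1
  refine Finset.sum_congr rfl fun j _ => ?_
  rw [integral_smul_mul_stagePoly, smul_comm, mul_assoc, Complex.real_smul (x := h)]

theorem IsStages.hasDerivAt_test (hc : Function.Injective c) (hc0 : ∀ i, c i ≠ 0)
    (hq : (h : ℂ) * μ = q) {y₀ : ℂ} {Y : Fin s → ℂ} (hY : IsStages c (fun y => μ * y) h y₀ Y)
    (τ : ℝ) : HasDerivAt (stagePoly c y₀ Y)
      (q * ∑ j : Fin s, (orthoLegendre j).eval τ • stageCoeff c y₀ Y j) τ := by
  refine (hY.hasDerivAt hc hc0 τ).congr_deriv ?_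
  rw [Finset.smul_sum, Finset.mul_sum]
  refine Finset.sum_congr rfl fun j _ => ?_
  rw [integral_smul_mul_stagePoly, ← hq, mul_smul_comm, mul_assoc, smul_comm h,
    Complex.real_smul (x := h)]

theorem inner_self_mul (q z : ℂ) : inner ℝ z (q * z) = q.re * ‖z‖ ^ 2 := by
  rw [Complex.inner, mul_assoc, Complex.mul_conj, Complex.normSq_eq_norm_sq,
    Complex.re_mul_ofReal]

/-- The energy balance of one step. -/
theorem IsStages.norm_sq_test (hc : Function.Injective c) (hc0 : ∀ i, c i ≠ 0)
    (hq : (h : ℂ) * μ = q) {y₀ : ℂ} {Y : Fin s → ℂ} (hY : IsStages c (fun y => μ * y) h y₀ Y) :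
    ‖stagePoly c y₀ Y 1‖ ^ 2 = ‖y₀‖ ^ 2 + 2 * q.re * ∑ j : Fin s, ‖stageCoeff c y₀ Y j‖ ^ 2 := by
  set σ := stagePoly c y₀ Y with hσ
  set g : Fin s → ℂ := fun j => stageCoeff c y₀ Y j with hg
  have hσc : Continuous σ := continuous_stagePoly c y₀ Y
  have hd : ∀ τ, HasDerivAt (fun t => ‖σ t‖ ^ 2)
      (2 * inner ℝ (σ τ) (q * ∑ j : Fin s, (orthoLegendre j).eval τ • g j)) τ := fun τ =>
    (hY.hasDerivAt_test hc hc0 hq τ).norm_sq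
  -- Moving the scalar P_j(τ) onto σ makes each summand a fixed linear functional of P_j σ, so its
  -- integral is that functional at the coefficient `g j`.
  have hexp : ∀ τ, 2 * inner ℝ (σ τ) (q * ∑ j : Fin s, (orthoLegendre j).eval τ • g j) =
      ∑ j : Fin s, 2 * innerSL ℝ (q * g j) ((orthoLegendre j).eval τ • σ τ) := by
    intro τ
    rw [Finset.mul_sum, inner_sum, Finset.mul_sum]
    refine Finset.sum_congr rfl fun j _ => ?_
    rw [mul_smul_comm, inner_smul_right, innerSL_apply_apply, inner_smul_right, real_inner_comm]
  have hint : ∀ j : Fin s, IntervalIntegrable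
      (fun τ => (orthoLegendre j).eval τ • σ τ) volume 0 1 := fun j =>
    ((orthoLegendre j).continuous.smul hσc).intervalIntegrable _ _
  have hint2 : ∀ j : Fin s, IntervalIntegrable
      (fun τ => 2 * innerSL ℝ (q * g j) ((orthoLegendre j).eval τ • σ τ)) volume 0 1 := fun j =>
    (continuous_const.mul ((innerSL ℝ (q * g j)).continuous.comp
      ((orthoLegendre j).continuous.smul hσc))).intervalIntegrable _ _
  simp only [hexp] at hd
  have hFTC := intervalIntegral.integral_eq_sub_of_hasDerivAt (a := 0) (b := 1)
    (fun τ _ => hd τ) (by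
      have := IntervalIntegrable.sum Finset.univ fun j _ => hint2 j
      simpa only [Finset.sum_fn] using this)
  rw [intervalIntegral.integral_finsetSum fun j _ => hint2 j] at hFTC
  have h0 : σ 0 = y₀ := stagePoly_zero hc0 hc y₀ Y
  rw [h0] at hFTC
  have hj : ∀ j : Fin s, ∫ τ in (0 : ℝ)..1,
      2 * innerSL ℝ (q * g j) ((orthoLegendre j).eval τ • σ τ) = 2 * q.re * ‖g j‖ ^ 2 := by
    intro j
    rw [intervalIntegral.integral_const_mul, ContinuousLinearMap.intervalIntegral_comp_comm _
      (hint j), innerSL_apply_apply, real_inner_comm, mul_assoc, ← inner_self_mul]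
    rfl
  simp only [hj, ← Finset.mul_sum] at hFTC
  linarith

/-- If every coefficient vanished, then σ' = 0 and σ = y₀ throughout; but since P_0 = 1 the
coefficient of index 0 would be y₀ itself. -/
theorem IsStages.exists_stageCoeff_ne_zero (hs : 1 ≤ s) (hc : Function.Injective c)
    (hc0 : ∀ i, c i ≠ 0) {y₀ : ℂ} {Y : Fin s → ℂ} (hY : IsStages c (fun y => μ * y) h y₀ Y)
    (hy : y₀ ≠ 0) : 0 < ∑ j : Fin s, ‖stageCoeff c y₀ Y j‖ ^ 2 := by
  by_contra hle
  have h0 : ∑ j : Fin s, ‖stageCoeff c y₀ Y j‖ ^ 2 = 0 :=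
    le_antisymm (not_lt.1 hle) (Finset.sum_nonneg fun _ _ => by positivity)
  rw [Finset.sum_eq_zero_iff_of_nonneg fun _ _ => by positivity] at h0
  have hz : ∀ j : Fin s, stageCoeff c y₀ Y j = 0 := fun j => by simpa using h0 j (Finset.mem_univ j)
  have hconst : ∀ τ, stagePoly c y₀ Y τ = y₀ := fun τ => by
    rw [hY.stagePoly_test hc hc0 rfl]; simp [hz]
  have hj := hz ⟨0, hs⟩
  simp [stageCoeff, hconst, orthoLegendre, shiftedLegendre] at hj
  exact hy hj

/-- As σ(0) = 0, write σ = τG with G of degree below s. Then G is an admissible test function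
against the defect σ - Πσ, and testing σ' = q Πσ with G gives |G(1)|² + ∫|G|² = 2 Re q ∫ τ|G|² ≤ 0,
so G vanishes on [0,1]. Testing with σ itself would not do: its degree may be s, and its energy
identity does not control Re q = 0. -/
theorem IsStages.eq_zero_of_re_nonpos (hc : Function.Injective c) (hc0 : ∀ i, 0 < c i ∧ c i ≤ 1)
    (hq : (h : ℂ) * μ = q) (hre : q.re ≤ 0) {Y : Fin s → ℂ}
    (hY : IsStages c (fun y => μ * y) h 0 Y) : Y = 0 := by
  have hc0' : ∀ i, c i ≠ 0 := fun i => (hc0 i).1.ne'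
  set σ := stagePoly c 0 Y with hσ
  set g : Fin s → ℂ := fun j => stageCoeff c 0 Y j with hg
  have hσc : Continuous σ := continuous_stagePoly c 0 Y
  let p : Fin s → ℝ[X] := fun j => primitiveDivX (orthoLegendre j)
  let G : ℝ → ℂ := fun τ => ∑ j : Fin s, (p j).eval τ • (q * g j)
  let G' : ℝ → ℂ := fun τ => ∑ j : Fin s, (derivative (p j)).eval τ • (q * g j)
  let w : ℝ → ℂ := fun τ => ∑ j : Fin s, (orthoLegendre j).eval τ • g j
  have hGc : Continuous G := continuous_finsetSum _ fun j _ =>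
    (Polynomial.continuous _).smul continuous_const
  have hwc : Continuous w := continuous_finsetSum _ fun j _ =>
    (Polynomial.continuous _).smul continuous_const
  have hGd : ∀ τ, HasDerivAt G (G' τ) τ := fun τ =>
    HasDerivAt.fun_sum fun j _ => ((p j).hasDerivAt τ).smul_const _
  have hσG : ∀ τ, σ τ = τ • G τ := by
    intro τ
    rw [hσ, hY.stagePoly_test hc hc0' hq, zero_add, Finset.smul_sum]
    refine Finset.sum_congr rfl fun j _ => ?_
    rw [integral_orthoLegendre, eval_mul, eval_X, mul_smul]
  have hwG : ∀ τ, q * w τ = G τ + τ • G' τ := by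
    intro τ
    have h1 := hY.hasDerivAt_test hc hc0' hq τ
    have h2 : HasDerivAt (stagePoly c 0 Y) (τ • G' τ + (1 : ℝ) • G τ) τ := by
      refine HasDerivAt.congr_of_eventuallyEq ?_ (Filter.Eventually.of_forall hσG)
      exact (hasDerivAt_id τ).fun_smul (hGd τ)
    rw [one_smul, add_comm] at h2
    exact h1.unique h2
  have horth : ∫ τ in (0 : ℝ)..1, inner ℝ (G τ) (q * (σ τ - w τ)) = 0 := by
    have he : ∀ τ, inner ℝ (G τ) (q * (σ τ - w τ)) = ∑ j : Fin s,
        ((innerSL ℝ (q * g j)).comp ((ContinuousLinearMap.mul ℝ ℂ) q))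
          ((p j).eval τ • (σ τ - w τ)) := by
      intro τ
      simp only [G, sum_inner]
      refine Finset.sum_congr rfl fun j _ => ?_
      rw [map_smul, real_inner_smul_left]; rfl
    have hint : ∀ j, IntervalIntegrable (fun τ => (p j).eval τ • (σ τ - w τ)) volume 0 1 := fun j =>
      ((Polynomial.continuous _).smul (hσc.sub hwc)).intervalIntegrable _ _
    simp only [he]
    rw [intervalIntegral.integral_finsetSum]
    swap
    · intro j _
      exact ((ContinuousLinearMap.continuous _).comp
        ((p j).continuous.smul (hσc.sub hwc))).intervalIntegrable _ _
    refine Finset.sum_eq_zero fun j _ => ?_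
    rw [ContinuousLinearMap.intervalIntegral_comp_comm _ (hint j)]
    have := integral_smul_sub_projection (s := s) (w := σ) hσc.continuousOn (p := p j) (by
      refine degree_le_natDegree.trans_lt ?_
      have h1 := natDegree_primitiveDivX_le (orthoLegendre j)
      rw [natDegree_orthoLegendre] at h1
      exact_mod_cast h1.trans_lt j.2)
    have h2 : (∫ τ in (0 : ℝ)..1, (p j).eval τ • (σ τ - w τ)) = 0 := this
    rw [h2, map_zero]
  -- The four multiples of ‖G‖² add up to -‖G‖². The identity follows from q Πσ = G + τG' on
  -- eliminating τ⟨G, G'⟩.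
  have hd : ∀ τ, HasDerivAt (fun t => t * ‖G t‖ ^ 2)
      (‖G τ‖ ^ 2 + 2 * (q.re * (τ * ‖G τ‖ ^ 2)) - 2 * ‖G τ‖ ^ 2 + ‖G τ‖ ^ 2 -
        2 * inner ℝ (G τ) (q * (σ τ - w τ)) - ‖G τ‖ ^ 2) τ := by
    intro τ
    refine ((hasDerivAt_id τ).fun_mul (hGd τ).norm_sq).congr_deriv ?_
    have e : inner ℝ (G τ) (q * (σ τ - w τ)) =
        τ * (q.re * ‖G τ‖ ^ 2) - ‖G τ‖ ^ 2 - τ * inner ℝ (G τ) (G' τ) := by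
      rw [mul_sub, hwG, hσG, mul_smul_comm, inner_sub_right, inner_add_right, real_inner_smul_right,
        real_inner_smul_right, inner_self_mul, real_inner_self_eq_norm_sq]
      ring
    rw [e]; simp; ring
  have hGn : Continuous fun τ => ‖G τ‖ ^ 2 := hGc.norm.pow 2
  have hI : Continuous fun τ => inner ℝ (G τ) (q * (σ τ - w τ)) :=
    hGc.inner (continuous_const.mul (hσc.sub hwc))
  have hFTC := intervalIntegral.integral_eq_sub_of_hasDerivAt (a := 0) (b := 1)
    (fun τ _ => hd τ) (by
      refine Continuous.intervalIntegrable ?_ _ _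
      fun_prop)
  have hsplit : ∫ τ in (0 : ℝ)..1, (‖G τ‖ ^ 2 + 2 * (q.re * (τ * ‖G τ‖ ^ 2)) - 2 * ‖G τ‖ ^ 2 +
      ‖G τ‖ ^ 2 - 2 * inner ℝ (G τ) (q * (σ τ - w τ)) - ‖G τ‖ ^ 2) =
      2 * (q.re * ∫ τ in (0 : ℝ)..1, τ * ‖G τ‖ ^ 2) - (∫ τ in (0 : ℝ)..1, ‖G τ‖ ^ 2) -
        2 * ∫ τ in (0 : ℝ)..1, inner ℝ (G τ) (q * (σ τ - w τ)) := by
    simp only [← intervalIntegral.integral_const_mul]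
    rw [← intervalIntegral.integral_sub, ← intervalIntegral.integral_sub]
    · congr 1; funext τ; ring
    all_goals exact Continuous.intervalIntegrable (by fun_prop) _ _
  rw [hsplit, horth] at hFTC
  have hpos : 0 ≤ ∫ τ in (0 : ℝ)..1, τ * ‖G τ‖ ^ 2 :=
    intervalIntegral.integral_nonneg zero_le_one fun τ hτ => mul_nonneg hτ.1 (by positivity)
  have hG0 : ∀ τ ∈ Set.Icc (0 : ℝ) 1, G τ = 0 := by
    by_contra hne
    push Not at hne
    obtain ⟨τ, hτ, hne⟩ := hne
    have := intervalIntegral.integral_pos zero_lt_one hGn.continuousOn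
      (fun _ _ => by positivity) ⟨τ, hτ, by positivity⟩
    have h2 := mul_nonpos_of_nonpos_of_nonneg hre hpos
    have h3 : 0 ≤ ‖G 1‖ ^ 2 := by positivity
    linarith
  funext i
  have : Y i = σ (c i) := by rw [hσ, hY.stagePoly_eq hc hc0']; exact hY i
  rw [this, hσG, hG0 _ ⟨(hc0 i).1.le, (hc0 i).2⟩]; simp

theorem testSolvable_of_re_nonpos (hc : Function.Injective c) (hc0 : ∀ i, 0 < c i ∧ c i ≤ 1)
    (hq : (h : ℂ) * μ = q) (hre : q.re ≤ 0) : TestSolvable c μ h := fun y₀ =>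
  existsUnique_isStages_of_forall_eq_zero (ContinuousLinearMap.mul ℝ ℂ μ)
    (fun _ hY => IsStages.eq_zero_of_re_nonpos hc hc0 hq hre hY) y₀

theorem IsStages.mul_left {y₀ : ℂ} {Y : Fin s → ℂ} (hY : IsStages c (fun y => μ * y) h y₀ Y)
    (a : ℂ) : IsStages c (fun y => μ * y) h (a * y₀) (fun i => a * Y i) :=
  hY.map (ContinuousLinearMap.mul ℝ ℂ a) (continuous_const_mul μ) fun x => by
    simp [mul_left_comm]

theorem stagePoly_mul_left (a y₀ : ℂ) (Y : Fin s → ℂ) (τ : ℝ) :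
    stagePoly c (a * y₀) (fun i => a * Y i) τ = a * stagePoly c y₀ Y τ :=
  stagePoly_map (LinearMap.mul ℝ ℂ a) y₀ Y τ

theorem isTestSolution_pow {Y : Fin s → ℂ} (hY : IsStages c (fun y => μ * y) h 1 Y) :
    IsTestSolution c μ h fun n => stagePoly c 1 Y 1 ^ n := fun n => by
  refine ⟨fun i => stagePoly c 1 Y 1 ^ n * Y i, ?_, ?_⟩
  · simpa using hY.mul_left (stagePoly c 1 Y 1 ^ n)
  · have := stagePoly_mul_left (c := c) (stagePoly c 1 Y 1 ^ n) 1 Y 1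
    rw [mul_one] at this
    simp only [this, pow_succ]

theorem IsTestSolution.eq_mul_pow (hsol : TestSolvable c μ h) {Y : Fin s → ℂ}
    (hY : IsStages c (fun y => μ * y) h 1 Y) {u : ℕ → ℂ} (hu : IsTestSolution c μ h u) (n : ℕ) :
    u n = u 0 * stagePoly c 1 Y 1 ^ n := by
  induction n with
  | zero => simp
  | succ n ih =>
    obtain ⟨Z, hZ, hz⟩ := hu n
    have h1 := hY.mul_left (u n)
    rw [mul_one] at h1
    have h2 := stagePoly_mul_left (c := c) (u n) 1 Y 1
    rw [mul_one, (hsol (u n)).unique h1 hZ, ← hz] at h2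
    rw [h2, ih, pow_succ, mul_assoc]

theorem norm_stability_lt_one (hs : 1 ≤ s) (hc : Function.Injective c) (hc0 : ∀ i, c i ≠ 0)
    (hq : (h : ℂ) * μ = q) {Y : Fin s → ℂ} (hY : IsStages c (fun y => μ * y) h 1 Y)
    (hre : q.re < 0) : ‖stagePoly c 1 Y 1‖ < 1 := by
  have h1 := hY.norm_sq_test hc hc0 hq
  have h2 := hY.exists_stageCoeff_ne_zero hs hc hc0 one_ne_zero
  rw [← sq_lt_one_iff₀ (norm_nonneg _), h1, norm_one]
  nlinarith

theorem one_lt_norm_stability (hs : 1 ≤ s) (hc : Function.Injective c) (hc0 : ∀ i, c i ≠ 0)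
    (hq : (h : ℂ) * μ = q) {Y : Fin s → ℂ} (hY : IsStages c (fun y => μ * y) h 1 Y)
    (hre : 0 < q.re) : 1 < ‖stagePoly c 1 Y 1‖ := by
  have h1 := hY.norm_sq_test hc hc0 hq
  have h2 := hY.exists_stageCoeff_ne_zero hs hc hc0 one_ne_zero
  rw [← one_lt_sq_iff₀ (norm_nonneg _), h1, norm_one]
  nlinarith

theorem norm_stability_eq_one (hc : Function.Injective c) (hc0 : ∀ i, c i ≠ 0)
    (hq : (h : ℂ) * μ = q) {Y : Fin s → ℂ} (hY : IsStages c (fun y => μ * y) h 1 Y)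
    (hre : q.re = 0) : ‖stagePoly c 1 Y 1‖ = 1 := by
  have h1 := hY.norm_sq_test hc hc0 hq
  rw [hre, norm_one, mul_zero, zero_mul, add_zero] at h1
  exact (pow_eq_one_iff_of_nonneg (norm_nonneg _) two_ne_zero).1 (by rw [h1, one_pow])

theorem perfectlyAStable (hs : 1 ≤ s) (hc : Function.Injective c)
    (hc01 : ∀ i, 0 < c i ∧ c i ≤ 1) : PerfectlyAStable c := by
  have hc0 : ∀ i, c i ≠ 0 := fun i => (hc01 i).1.ne'
  refine ⟨Set.ext fun q => ⟨fun hq => ?_, fun hre μ h hh hq => ?_⟩,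
    Set.ext fun q => ⟨fun hq => ?_, fun hre μ h hh hq => ?_⟩⟩
  -- Membership is tested at h = 1, μ = q, on the solution starting at 1: the powers of the
  -- stability function, which cannot tend to 0 if its modulus is at least 1.
  · obtain ⟨hsol, hu⟩ := hq q 1 one_pos (by simp)
    obtain ⟨Y, hY, -⟩ := hsol 1
    have hlim := (hu _ (isTestSolution_pow hY)).norm
    rw [norm_zero] at hlim
    by_contra hre
    have h1 : 1 ≤ ‖stagePoly c 1 Y 1‖ := by
      rcases (show 0 ≤ q.re from not_lt.1 hre).eq_or_lt with h | h
      · exact (norm_stability_eq_one hc hc0 (by simp) hY h.symm).ge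
      · exact (one_lt_norm_stability hs hc hc0 (by simp) hY h).le
    have := ge_of_tendsto' hlim (b := 1) fun n => by rw [norm_pow]; exact one_le_pow₀ h1
    linarith
  · have hsol := testSolvable_of_re_nonpos hc hc01 hq (le_of_lt hre)
    refine ⟨hsol, fun u hu => ?_⟩
    obtain ⟨Y, hY, -⟩ := hsol 1
    rw [funext (hu.eq_mul_pow hsol hY)]
    have := tendsto_pow_atTop_nhds_zero_of_norm_lt_one
      (norm_stability_lt_one hs hc hc0 hq hY hre)
    simpa using this.const_mul (u 0)
  · obtain ⟨hsol, hu⟩ := hq q 1 one_pos (by simp)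
    obtain ⟨Y, hY, -⟩ := hsol 1
    obtain ⟨B, hB⟩ := hu _ (isTestSolution_pow hY)
    by_contra hre
    have h1 := one_lt_norm_stability hs hc hc0 (by simp) hY (not_le.1 hre)
    obtain ⟨n, hn⟩ := pow_unbounded_of_one_lt B h1
    have := hB n
    rw [norm_pow] at this
    linarith
  · have hsol := testSolvable_of_re_nonpos hc hc01 hq hre
    refine ⟨hsol, fun u hu => ⟨‖u 0‖, fun n => ?_⟩⟩
    obtain ⟨Y, hY, -⟩ := hsol 1
    rw [hu.eq_mul_pow hsol hY, norm_mul, norm_pow]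
    refine mul_le_of_le_one_right (norm_nonneg _) (pow_le_one₀ (norm_nonneg _) ?_)
    rcases (show q.re ≤ 0 from hre).eq_or_lt with h | h
    · exact (norm_stability_eq_one hc hc0 hq hY h).le
    · exact (norm_stability_lt_one hs hc hc0 hq hY h).le

end test

/-! ### Nonlinear problems: solvability of the stages, and the exact flow near the initial value. -/

section local_data

variable {E : Type*} [NormedAddCommGroup E] [NormedSpace ℝ E]

/-- The projection and its primitive are bounded in the sup norm on [0,1]. The second bound makes
the stage map contractive; the first controls the defect. -/
theorem exists_projection_bound (s : ℕ) (E : Type*) [NormedAddCommGroup E] [NormedSpace ℝ E] :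
    ∃ B : ℝ, 0 ≤ B ∧ ∀ (w : ℝ → E) (M : ℝ), (∀ x ∈ Set.Icc (0 : ℝ) 1, ‖w x‖ ≤ M) →
      ∀ τ ∈ Set.Icc (0 : ℝ) 1,
        ‖∑ j : Fin s, (orthoLegendre j).eval τ •
          ∫ t in (0 : ℝ)..1, (orthoLegendre j).eval t • w t‖ ≤ B * M ∧
        ‖∑ j : Fin s, (∫ x in (0 : ℝ)..τ, (orthoLegendre j).eval x) •
          ∫ t in (0 : ℝ)..1, (orthoLegendre j).eval t • w t‖ ≤ B * M := by
  have hcont : Continuous fun τ : ℝ => ∑ j : Fin s, |(orthoLegendre j).eval τ| :=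
    continuous_finsetSum _ fun _ _ => (Polynomial.continuous _).abs
  obtain ⟨b, hb⟩ := (isCompact_Icc (a := (0 : ℝ)) (b := 1)).exists_bound_of_continuousOn
    hcont.continuousOn
  have hbj : ∀ j : Fin s, ∀ x ∈ Set.Icc (0 : ℝ) 1, |(orthoLegendre j).eval x| ≤ b := by
    intro j x hx
    refine le_trans ?_ ((le_abs_self _).trans (hb x hx))
    exact Finset.single_le_sum (f := fun j : Fin s => |(orthoLegendre j).eval x|)
      (fun _ _ => abs_nonneg _) (Finset.mem_univ j)
  have hb0 : 0 ≤ b := (norm_nonneg _).trans (hb 0 ⟨le_rfl, zero_le_one⟩)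
  refine ⟨s * (b * b), by positivity, fun w M hw τ hτ => ?_⟩
  have hM : 0 ≤ M := (norm_nonneg _).trans (hw 0 ⟨le_rfl, zero_le_one⟩)
  have hint : ∀ j : Fin s, ‖∫ t in (0 : ℝ)..1, (orthoLegendre j).eval t • w t‖ ≤ b * M := by
    intro j
    have := intervalIntegral.norm_integral_le_of_norm_le_const (a := 0) (b := 1) (C := b * M)
      (f := fun t => (orthoLegendre j).eval t • w t) (fun x hx => by
        rw [Set.uIoc_of_le zero_le_one] at hx
        have hx' : x ∈ Set.Icc (0 : ℝ) 1 := ⟨hx.1.le, hx.2⟩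
        rw [norm_smul]
        exact mul_le_mul (hbj j x hx') (hw x hx') (norm_nonneg _) hb0)
    simpa using this
  have hprim : ∀ j : Fin s, |∫ x in (0 : ℝ)..τ, (orthoLegendre j).eval x| ≤ b := by
    intro j
    have := intervalIntegral.norm_integral_le_of_norm_le_const (a := 0) (b := τ) (C := b)
      (f := fun t => (orthoLegendre j).eval t) (fun x hx => by
        rw [Set.uIoc_of_le hτ.1] at hx
        exact hbj j x ⟨hx.1.le, hx.2.trans hτ.2⟩)
    rw [sub_zero, abs_of_nonneg hτ.1] at this
    exact this.trans (mul_le_of_le_one_right hb0 hτ.2)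
  have hsum : ∀ a : Fin s → ℝ, (∀ j, |a j| ≤ b) →
      ‖∑ j : Fin s, a j • ∫ t in (0 : ℝ)..1, (orthoLegendre j).eval t • w t‖ ≤
        s * (b * b) * M := by
    intro a ha
    calc _ ≤ ∑ _j : Fin s, b * (b * M) := norm_sum_le_of_le _ fun j _ => by
          rw [norm_smul]
          exact mul_le_mul (ha j) (hint j) (norm_nonneg _) hb0
      _ = _ := by simp; ring
  exact ⟨hsum _ fun j => hbj j τ hτ, hsum _ hprim⟩

theorem intervalIntegrable_eval_smul {w : ℝ → E} (hw : ContinuousOn w (Set.Icc 0 1)) (p : ℝ[X]) :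
    IntervalIntegrable (fun x => p.eval x • w x) volume 0 1 := by
  rw [← Set.uIcc_of_le zero_le_one] at hw
  exact (continuousOn_eval_smul hw p).intervalIntegrable

section stages

variable {s : ℕ} {c : Fin s → ℝ}

/-- Solvability of the stage equations near `y₀` for a locally Lipschitz vector field. -/
theorem exists_radius_existsUnique_isStages [CompleteSpace E] (hc : Function.Injective c)
    (hc01 : ∀ i, 0 < c i ∧ c i ≤ 1) {f : E → E} {y₀ : E} {r C : ℝ} (hr : 0 < r) (hC : 0 ≤ C)
    (hf : ∀ x ∈ Metric.closedBall y₀ r, ∀ z ∈ Metric.closedBall y₀ r, ‖f x - f z‖ ≤ C * ‖x - z‖) :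
    ∃ ρ > 0, ∃ h₀ > 0, (∀ Y : Fin s → E, (∀ i, Y i ∈ Metric.closedBall y₀ ρ) →
        ∀ τ ∈ Set.Icc (0 : ℝ) 1, stagePoly c y₀ Y τ ∈ Metric.closedBall y₀ r) ∧
      ∀ h : ℝ, 0 < h → h ≤ h₀ →
        ∃! Y : Fin s → E, IsStages c f h y₀ Y ∧ ∀ i, Y i ∈ Metric.closedBall y₀ ρ := by
  have hc0 : ∀ i, c i ≠ 0 := fun i => (hc01 i).1.ne'
  obtain ⟨Λ, hΛ1, hΛ⟩ := exists_norm_stagePoly_sub_le c E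
  obtain ⟨B, hB0, hB⟩ := exists_projection_bound s E
  have hΛ0 : 0 < Λ := by linarith
  set M := ‖f y₀‖ + C * r with hM
  have hM0 : 0 ≤ M := by positivity
  have hfM : ∀ x ∈ Metric.closedBall y₀ r, ‖f x‖ ≤ M := by
    intro x hx
    have h1 := hf x hx y₀ (Metric.mem_closedBall_self hr.le)
    have h2 : ‖x - y₀‖ ≤ r := by rwa [← mem_closedBall_iff_norm]
    have h3 := norm_le_norm_add_norm_sub' (f x) (f y₀)
    have h4 := mul_le_mul_of_nonneg_left h2 hC
    linarith
  -- With this radius, stages within `ρ` of `y₀` keep the whole stage polynomial within `r`, where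
  -- the Lipschitz bound holds.
  set ρ := r / Λ with hρ
  have hρ0 : 0 < ρ := by positivity
  have hball : ∀ Y : Fin s → E, (∀ i, Y i ∈ Metric.closedBall y₀ ρ) →
      Y ∈ Metric.closedBall (fun _ => y₀ : Fin s → E) ρ := fun Y hY =>
    (dist_pi_le_iff hρ0.le).2 hY
  have hσ : ∀ Y ∈ Metric.closedBall (fun _ => y₀ : Fin s → E) ρ, ∀ τ ∈ Set.Icc (0 : ℝ) 1,
      stagePoly c y₀ Y τ ∈ Metric.closedBall y₀ r := by
    intro Y hY τ hτ
    have h1 := hΛ y₀ Y (fun _ => y₀) τ hτ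
    rw [stagePoly_const hc hc0] at h1
    rw [mem_closedBall_iff_norm] at hY ⊢
    refine h1.trans ((mul_le_mul_of_nonneg_left hY hΛ0.le).trans_eq ?_)
    rw [hρ]; field_simp
  have hfc : ContinuousOn f (Metric.closedBall y₀ r) := by
    refine (LipschitzOnWith.of_dist_le_mul (K := ⟨C, hC⟩) fun x hx z hz => ?_).continuousOn
    rw [dist_eq_norm, dist_eq_norm]; exact hf x hx z hz
  have hwc : ∀ Y ∈ Metric.closedBall (fun _ => y₀ : Fin s → E) ρ,
      ContinuousOn (fun τ => f (stagePoly c y₀ Y τ)) (Set.Icc 0 1) := fun Y hY =>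
    hfc.comp (continuous_stagePoly c y₀ Y).continuousOn (hσ Y hY)
  let T : ℝ → (Fin s → E) → Fin s → E := fun h Y i => y₀ + h • ∑ j : Fin s,
    (∫ x in (0 : ℝ)..(c i), (orthoLegendre j).eval x) •
      ∫ τ in (0 : ℝ)..1, (orthoLegendre j).eval τ • f (stagePoly c y₀ Y τ)
  have hT : ∀ h Y, IsStages c f h y₀ Y ↔ T h Y = Y := fun h Y => by
    rw [funext_iff]; exact forall_congr' fun i => eq_comm
  have hself : ∀ h, 0 < h → h * (B * M) ≤ ρ →
      ∀ Y ∈ Metric.closedBall (fun _ => y₀ : Fin s → E) ρ,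
        T h Y ∈ Metric.closedBall (fun _ => y₀ : Fin s → E) ρ := by
    intro h hh hle Y hY
    refine (dist_pi_le_iff hρ0.le).2 fun i => ?_
    rw [dist_eq_norm, add_sub_cancel_left, norm_smul, Real.norm_of_nonneg hh.le]
    refine le_trans (mul_le_mul_of_nonneg_left ?_ hh.le) hle
    exact (hB _ M (fun x hx => hfM _ (hσ Y hY x hx)) (c i) ⟨(hc01 i).1.le, (hc01 i).2⟩).2
  have hcontr : ∀ h, 0 < h → h * (B * (C * Λ)) ≤ 1 / 2 →
      ∀ Y ∈ Metric.closedBall (fun _ => y₀ : Fin s → E) ρ,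
      ∀ Z ∈ Metric.closedBall (fun _ => y₀ : Fin s → E) ρ,
        ‖T h Y - T h Z‖ ≤ 1 / 2 * ‖Y - Z‖ := by
    intro h hh hle Y hY Z hZ
    refine (pi_norm_le_iff_of_nonneg (by positivity)).2 fun i => ?_
    have e : (T h Y - T h Z) i = h • ∑ j : Fin s,
        (∫ x in (0 : ℝ)..(c i), (orthoLegendre j).eval x) • ∫ τ in (0 : ℝ)..1,
          (orthoLegendre j).eval τ • (f (stagePoly c y₀ Y τ) - f (stagePoly c y₀ Z τ)) := by
      simp only [smul_sub]
      simp only [intervalIntegral.integral_sub (intervalIntegrable_eval_smul (hwc Y hY) _)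
        (intervalIntegrable_eval_smul (hwc Z hZ) _), smul_sub, Finset.sum_sub_distrib, T,
        Pi.sub_apply]
      abel
    rw [e, norm_smul, Real.norm_of_nonneg hh.le]
    have h1 := (hB (fun τ => f (stagePoly c y₀ Y τ) - f (stagePoly c y₀ Z τ))
      (C * (Λ * ‖Y - Z‖)) (fun x hx => (hf _ (hσ Y hY x hx) _ (hσ Z hZ x hx)).trans
        (mul_le_mul_of_nonneg_left (hΛ y₀ Y Z x hx) hC)) (c i) ⟨(hc01 i).1.le, (hc01 i).2⟩).2
    calc _ ≤ h * (B * (C * (Λ * ‖Y - Z‖))) := mul_le_mul_of_nonneg_left h1 hh.le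
      _ = h * (B * (C * Λ)) * ‖Y - Z‖ := by ring
      _ ≤ _ := mul_le_mul_of_nonneg_right hle (norm_nonneg _)
  -- The first threshold makes the ball invariant under the stage map, the second makes the map a
  -- contraction with factor 1/2; each + 1 only keeps a denominator positive.
  refine ⟨ρ, hρ0, min (ρ / (B * M + 1)) (1 / (2 * (B * (C * Λ) + 1))), by positivity,
    fun Y hY => hσ Y (hball Y hY), fun h hh hle => ?_⟩
  have h1 : h * (B * M) ≤ ρ := by
    have := hle.trans (min_le_left _ _)
    rw [le_div_iff₀ (by positivity)] at this
    nlinarith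
  have h2 : h * (B * (C * Λ)) ≤ 1 / 2 := by
    have := hle.trans (min_le_right _ _)
    rw [le_div_iff₀ (by positivity)] at this
    nlinarith
  have hmaps : Set.MapsTo (T h) (Metric.closedBall (fun _ => y₀ : Fin s → E) ρ)
      (Metric.closedBall (fun _ => y₀ : Fin s → E) ρ) := hself h hh h1
  have hctr : ContractingWith (1 / 2) (hmaps.restrict (T h) _ _) := by
    refine ⟨by rw [div_lt_one] <;> norm_num, LipschitzWith.of_dist_le_mul fun Y Z => ?_⟩
    have := hcontr h hh h2 Y Y.2 Z Z.2
    rw [Subtype.dist_eq, Subtype.dist_eq, dist_eq_norm, dist_eq_norm]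
    simpa using this
  obtain ⟨Y, hY, hfix, -⟩ := hctr.exists_fixedPoint' Metric.isClosed_closedBall.isComplete hmaps
    (Metric.mem_closedBall_self hρ0.le) (edist_ne_top _ _)
  refine ⟨Y, ⟨(hT h Y).2 hfix, (dist_pi_le_iff hρ0.le).1 hY⟩, fun Z hZ => ?_⟩
  have h3 := hcontr h hh h2 Z (hball Z hZ.2) Y hY
  rw [(hT h Z).1 hZ.1, hfix] at h3
  rw [← sub_eq_zero, ← norm_le_zero_iff]
  linarith

end stages

/-- The exact solution through `y₀` on `[0, δ]` together with the solution of the adjoint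
variational equation, their Taylor approximations at `0`, and bounds for the vector field
on a ball. -/
structure VariationalData (f : E → E) (f' : E → E →L[ℝ] E) (y₀ : E) (s : ℕ) (r δ C : ℝ)
    (η : ℝ → E) (Φ : ℝ → E →L[ℝ] E) (a : ℕ → E) (A : ℕ → E →L[ℝ] E) : Prop where
  r_pos : 0 < r
  delta_pos : 0 < δ
  C_nonneg : 0 ≤ C
  lipschitz : ∀ x ∈ Metric.closedBall y₀ r, ∀ z ∈ Metric.closedBall y₀ r,
    ‖f x - f z‖ ≤ C * ‖x - z‖
  continuousOn_deriv : ContinuousOn f' (Metric.closedBall y₀ r)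
  taylor_field : ∀ x ∈ Metric.closedBall y₀ r, ∀ z ∈ Metric.closedBall y₀ r,
    ‖f x - f z - f' z (x - z)‖ ≤ C * ‖x - z‖ ^ 2
  init : η 0 = y₀
  mem_ball : ∀ t ∈ Set.Icc 0 δ, η t ∈ Metric.closedBall y₀ r
  hasDerivAt : ∀ t ∈ Set.Icc 0 δ, HasDerivAt η (f (η t)) t
  hasDerivAt_adjoint : ∀ t ∈ Set.Icc 0 δ, HasDerivAt Φ (-(Φ t ∘L f' (η t))) t
  norm_adjoint_sub_one : ∀ t ∈ Set.Icc 0 δ, ‖Φ t - 1‖ ≤ 1 / 2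
  taylor : ∀ t ∈ Set.Icc 0 δ, ‖f (η t) - ∑ i ∈ Finset.range s, t ^ i • a i‖ ≤ C * t ^ s
  taylor_adjoint : ∀ t ∈ Set.Icc 0 δ, ‖Φ t - ∑ i ∈ Finset.range s, t ^ i • A i‖ ≤ C * t ^ s

namespace VariationalData

variable {f : E → E} {f' : E → E →L[ℝ] E} {y₀ : E} {s : ℕ} {r δ C : ℝ}
    {η : ℝ → E} {Φ : ℝ → E →L[ℝ] E} {a : ℕ → E} {A : ℕ → E →L[ℝ] E}

theorem continuousOn (D : VariationalData f f' y₀ s r δ C η Φ a A) :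
    ContinuousOn f (Metric.closedBall y₀ r) := by
  refine (LipschitzOnWith.of_dist_le_mul (K := ⟨C, D.C_nonneg⟩) fun x hx z hz => ?_).continuousOn
  rw [dist_eq_norm, dist_eq_norm]; exact D.lipschitz x hx z hz

/-- Solutions that stay in the domain agree with `η` for a short time. -/
theorem exists_eq_of_isExactSolution (D : VariationalData f f' y₀ s r δ C η Φ a A) (U : Set E) :
    ∃ h₀ > 0, ∀ h, 0 < h → h ≤ h₀ → ∀ (t₀ : ℝ) (y : ℝ → E),
      IsExactSolution f U t₀ (t₀ + h) y₀ y → y (t₀ + h) = η h := by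
  set M := ‖f y₀‖ + C * r with hM
  have hM0 : 0 ≤ M := add_nonneg (norm_nonneg _) (mul_nonneg D.C_nonneg D.r_pos.le)
  have hfM : ∀ x ∈ Metric.closedBall y₀ r, ‖f x‖ ≤ M := by
    intro x hx
    have h1 := D.lipschitz x hx y₀ (Metric.mem_closedBall_self D.r_pos.le)
    have h2 : ‖x - y₀‖ ≤ r := by rwa [← mem_closedBall_iff_norm]
    have h3 := norm_le_norm_add_norm_sub' (f x) (f y₀)
    have h4 := mul_le_mul_of_nonneg_left h2 D.C_nonneg
    linarith
  -- An arbitrary solution in `U` must first be confined to the ball. The speed there is at most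
  -- `M`, strictly below `M + 1`, as the barrier argument requires.
  refine ⟨min δ (r / (M + 1)), lt_min D.delta_pos (div_pos D.r_pos (by linarith)),
    fun h hh hle t₀ y hy => ?_⟩
  have hδ : h ≤ δ := hle.trans (min_le_left _ _)
  have hrM : (M + 1) * h ≤ r := by
    have := hle.trans (min_le_right _ _)
    rwa [le_div_iff₀ (by linarith), mul_comm] at this
  have hyc : ContinuousOn y (Set.Icc t₀ (t₀ + h)) := fun t ht => (hy.2 t ht).2.continuousWithinAt
  have hyd : ∀ t ∈ Set.Ico t₀ (t₀ + h), HasDerivWithinAt y (f (y t)) (Set.Ici t) t :=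
    fun t ht => (hy.2 t ⟨ht.1, ht.2.le⟩).2.mono_of_mem_nhdsWithin (Icc_mem_nhdsGE_of_mem ht)
  have hstay : ∀ t ∈ Set.Icc t₀ (t₀ + h), ‖y t - y₀‖ ≤ (M + 1) * (t - t₀) := by
    intro t ht
    refine image_norm_le_of_norm_deriv_right_lt_deriv_boundary' (f := fun t => y t - y₀)
      (f' := fun t => f (y t)) (B := fun t => (M + 1) * (t - t₀)) (B' := fun _ => M + 1)
      (hyc.sub continuousOn_const) (fun x hx => (hyd x hx).sub_const y₀) ?_
      (by fun_prop) (fun x _ => ?_) (fun x hx hxB => ?_) ht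
    · simp [hy.1]
    · have := ((hasDerivAt_id x).sub_const t₀).const_mul (M + 1)
      rw [mul_one] at this
      exact this.hasDerivWithinAt
    · have hmem : y x ∈ Metric.closedBall y₀ r := by
        rw [mem_closedBall_iff_norm]
        refine hxB.le.trans (le_trans ?_ hrM)
        exact mul_le_mul_of_nonneg_left (by linarith [hx.2]) (by linarith)
      linarith [hfM _ hmem]
  have hmem : ∀ t ∈ Set.Ico t₀ (t₀ + h), y t ∈ Metric.closedBall y₀ r := by
    intro t ht
    rw [mem_closedBall_iff_norm]
    refine (hstay t ⟨ht.1, ht.2.le⟩).trans (le_trans ?_ hrM)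
    exact mul_le_mul_of_nonneg_left (by linarith [ht.2]) (by linarith)
  have hsh : ∀ t ∈ Set.Icc t₀ (t₀ + h), t - t₀ ∈ Set.Icc 0 δ := fun t ht =>
    ⟨by linarith [ht.1], by linarith [ht.2]⟩
  have hηd : ∀ t ∈ Set.Icc t₀ (t₀ + h), HasDerivAt (fun t => η (t - t₀)) (f (η (t - t₀))) t :=
    fun t ht => (D.hasDerivAt _ (hsh t ht)).comp_sub_const t t₀
  have := ODE_solution_unique_of_mem_Icc_right (v := fun _ => f) (K := ⟨C, D.C_nonneg⟩)
    (s := fun _ => Metric.closedBall y₀ r) (f := y) (g := fun t => η (t - t₀))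
    (a := t₀) (b := t₀ + h)
    (fun _ _ => LipschitzOnWith.of_dist_le_mul fun x hx z hz => by
      rw [dist_eq_norm, dist_eq_norm]; exact D.lipschitz x hx z hz)
    hyc hyd hmem (fun t ht => (hηd t ht).continuousAt.continuousWithinAt)
    (fun t ht => (hηd t ⟨ht.1, ht.2.le⟩).hasDerivWithinAt)
    (fun t ht => D.mem_ball _ (hsh t ⟨ht.1, ht.2.le⟩)) (by simp [hy.1, D.init])
  have h2 := this (Set.right_mem_Icc.2 (by linarith : t₀ ≤ t₀ + h))
  simpa using h2

end VariationalData

end local_data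

/-! ### Error estimates: order s+1 along the step, superconvergence at its end. -/

namespace VariationalData

variable {E : Type*} [NormedAddCommGroup E] [NormedSpace ℝ E]
variable {f : E → E} {f' : E → E →L[ℝ] E} {y₀ : E} {s : ℕ} {r δ C : ℝ}
    {η : ℝ → E} {Φ : ℝ → E →L[ℝ] E} {a : ℕ → E} {A : ℕ → E →L[ℝ] E} {c : Fin s → ℝ}

/-- The defect of the Legendre projection of the vector field along the stage polynomial. -/
noncomputable def defect (c : Fin s → ℝ) (f : E → E) (y₀ : E) (Y : Fin s → E) (τ : ℝ) : E :=
  f (stagePoly c y₀ Y τ) - ∑ j : Fin s, (orthoLegendre j).eval τ •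
    ∫ t in (0 : ℝ)..1, (orthoLegendre j).eval t • f (stagePoly c y₀ Y t)

/-- The defect operator 1 - Π annihilates polynomials of degree below s, so the Taylor polynomial of
f∘η may be subtracted from f(σ) before taking norms. -/
theorem norm_defect_le [CompleteSpace E] (D : VariationalData f f' y₀ s r δ C η Φ a A) {B : ℝ}
    (hB : ∀ (w : ℝ → E) (M : ℝ), (∀ x ∈ Set.Icc (0 : ℝ) 1, ‖w x‖ ≤ M) →
      ∀ τ ∈ Set.Icc (0 : ℝ) 1, ‖∑ j : Fin s, (orthoLegendre j).eval τ •
          ∫ t in (0 : ℝ)..1, (orthoLegendre j).eval t • w t‖ ≤ B * M)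
    {h : ℝ} (hh : 0 < h) (hhδ : h ≤ δ) {Y : Fin s → E}
    (hσ : ∀ τ ∈ Set.Icc (0 : ℝ) 1, stagePoly c y₀ Y τ ∈ Metric.closedBall y₀ r) {m : ℝ}
    (hm : ∀ τ ∈ Set.Icc (0 : ℝ) 1, ‖η (h * τ) - stagePoly c y₀ Y τ‖ ≤ m) :
    ∀ τ ∈ Set.Icc (0 : ℝ) 1, ‖defect c f y₀ Y τ‖ ≤ (1 + B) * (C * m + C * h ^ s) := by
  have hhτ : ∀ τ ∈ Set.Icc (0 : ℝ) 1, h * τ ∈ Set.Icc 0 δ := fun τ hτ =>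
    ⟨mul_nonneg hh.le hτ.1, (mul_le_of_le_one_right hh.le hτ.2).trans hhδ⟩
  have hwc : ContinuousOn (fun τ => f (stagePoly c y₀ Y τ)) (Set.Icc 0 1) :=
    D.continuousOn.comp (continuous_stagePoly c y₀ Y).continuousOn hσ
  set T : ℝ → E := fun τ => ∑ i ∈ Finset.range s, τ ^ i • (h ^ i • a i) with hT
  have hTc : Continuous T := by fun_prop
  have hwT : ∀ τ ∈ Set.Icc (0 : ℝ) 1,
      ‖f (stagePoly c y₀ Y τ) - T τ‖ ≤ C * m + C * h ^ s := by
    intro τ hτ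
    have h1 := D.lipschitz _ (hσ τ hτ) _ (D.mem_ball _ (hhτ τ hτ))
    have h2 := D.taylor _ (hhτ τ hτ)
    have e : ∑ i ∈ Finset.range s, (h * τ) ^ i • a i = T τ := by
      refine Finset.sum_congr rfl fun i _ => ?_
      rw [mul_pow, mul_comm, mul_smul]
    rw [e] at h2
    rw [norm_sub_rev (stagePoly c y₀ Y τ)] at h1
    have h3 := mul_le_mul_of_nonneg_left (hm τ hτ) D.C_nonneg
    have h4 : C * (h * τ) ^ s ≤ C * h ^ s :=
      mul_le_mul_of_nonneg_left (pow_le_pow_left₀ (hhτ τ hτ).1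
        (mul_le_of_le_one_right hh.le hτ.2) s) D.C_nonneg
    calc _ = ‖(f (stagePoly c y₀ Y τ) - f (η (h * τ))) + (f (η (h * τ)) - T τ)‖ := by
          congr 1; abel
      _ ≤ _ := (norm_add_le _ _).trans (by linarith)
  intro τ hτ
  have e : defect c f y₀ Y τ = (f (stagePoly c y₀ Y τ) - T τ) -
      ∑ j : Fin s, (orthoLegendre j).eval τ • ∫ t in (0 : ℝ)..1, (orthoLegendre j).eval t •
        (f (stagePoly c y₀ Y t) - T t) := by
    have hp := projection_polynomial (s := s) (fun i => h ^ i • a i) τ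
    simp only [smul_sub]
    simp only [intervalIntegral.integral_sub (intervalIntegrable_eval_smul hwc _)
      (intervalIntegrable_eval_smul hTc.continuousOn _), smul_sub, Finset.sum_sub_distrib, defect]
    rw [hp]
    simp only [hT]
    abel
  rw [e]
  refine (norm_sub_le _ _).trans ?_
  have := hB (fun t => f (stagePoly c y₀ Y t) - T t) _ hwT τ hτ
  linarith [hwT τ hτ]

theorem hasDerivAt_error (D : VariationalData f f' y₀ s r δ C η Φ a A)
    (hc : Function.Injective c) (hc0 : ∀ i, c i ≠ 0) {h : ℝ} {Y : Fin s → E}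
    (hY : IsStages c f h y₀ Y) {τ : ℝ} (hτ : h * τ ∈ Set.Icc 0 δ) :
    HasDerivAt (fun τ => η (h * τ) - stagePoly c y₀ Y τ)
      (h • (f (η (h * τ)) - f (stagePoly c y₀ Y τ)) + h • defect c f y₀ Y τ) τ := by
  have h1 : HasDerivAt (fun τ => η (h * τ)) (h • f (η (h * τ))) τ := by
    have h2 := (hasDerivAt_id τ).const_mul h
    rw [mul_one] at h2
    exact (D.hasDerivAt _ hτ).scomp τ h2
  refine (h1.fun_sub (hY.hasDerivAt hc hc0 τ)).congr_deriv ?_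
  simp only [defect, smul_sub]
  abel

/-- The first, non-optimal, bound of the error on the whole step. -/
theorem exists_norm_error_le [CompleteSpace E] (D : VariationalData f f' y₀ s r δ C η Φ a A)
    (hc : Function.Injective c) (hc0 : ∀ i, c i ≠ 0) :
    ∃ h₀ > 0, h₀ ≤ δ ∧ h₀ ≤ 1 ∧ ∃ K, 0 ≤ K ∧ ∀ h, 0 < h → h ≤ h₀ → ∀ Y : Fin s → E,
      IsStages c f h y₀ Y →
      (∀ τ ∈ Set.Icc (0 : ℝ) 1, stagePoly c y₀ Y τ ∈ Metric.closedBall y₀ r) →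
      ∀ τ ∈ Set.Icc (0 : ℝ) 1, ‖η (h * τ) - stagePoly c y₀ Y τ‖ ≤ K * h ^ (s + 1) ∧
        ‖defect c f y₀ Y τ‖ ≤ K * h ^ s := by
  obtain ⟨B, hB0, hB⟩ := exists_projection_bound s E
  have hC := D.C_nonneg
  -- `C` from the Lipschitz bound on f(η) - f(σ) plus `(1 + B) * C` from the part of the defect
  -- proportional to the error.
  set b := C * (2 + B) with hb
  have hb0 : 0 ≤ b := by positivity
  set K₁ := 2 * ((1 + B) * C) with hK₁
  have hK₁0 : 0 ≤ K₁ := by positivity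
  refine ⟨min (min δ 1) (1 / (2 * (b + 1))), lt_min (lt_min D.delta_pos one_pos) (by positivity),
    (min_le_left _ _).trans (min_le_left _ _), (min_le_left _ _).trans (min_le_right _ _),
    K₁ + (1 + B) * (C * K₁ + C), by positivity, fun h hh hle Y hY hσ => ?_⟩
  have hhδ : h ≤ δ := hle.trans ((min_le_left _ _).trans (min_le_left _ _))
  have hh1 : h ≤ 1 := hle.trans ((min_le_left _ _).trans (min_le_right _ _))
  have hhb : h * b ≤ 1 / 2 := by
    have := hle.trans (min_le_right _ _)
    rw [le_div_iff₀ (by positivity)] at this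
    nlinarith
  have hhτ : ∀ τ ∈ Set.Icc (0 : ℝ) 1, h * τ ∈ Set.Icc 0 δ := fun τ hτ =>
    ⟨mul_nonneg hh.le hτ.1, (mul_le_of_le_one_right hh.le hτ.2).trans hhδ⟩
  set e : ℝ → E := fun τ => η (h * τ) - stagePoly c y₀ Y τ with he
  have hed : ∀ τ ∈ Set.Icc (0 : ℝ) 1, HasDerivAt e _ τ := fun τ hτ =>
    D.hasDerivAt_error hc hc0 hY (hhτ τ hτ)
  have hec : ContinuousOn e (Set.Icc 0 1) := fun τ hτ =>
    (hed τ hτ).continuousAt.continuousWithinAt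
  -- The defect depends on σ over the whole step, so a pointwise Gronwall inequality does not apply.
  -- The maximal error `m` is estimated by itself instead, and its own contribution is absorbed
  -- using `h * b ≤ 1 / 2`.
  obtain ⟨τm, hτm, hmax⟩ := isCompact_Icc.exists_isMaxOn (Set.nonempty_Icc.2 zero_le_one) hec.norm
  set m := ‖e τm‖ with hm
  have hme : ∀ τ ∈ Set.Icc (0 : ℝ) 1, ‖e τ‖ ≤ m := fun τ hτ => hmax hτ
  have hdef := D.norm_defect_le (fun w M hw τ hτ => (hB w M hw τ hτ).1) hh hhδ hσ hme
  have hder : ∀ τ ∈ Set.Ico (0 : ℝ) 1,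
      ‖h • (f (η (h * τ)) - f (stagePoly c y₀ Y τ)) + h • defect c f y₀ Y τ‖ ≤
        h * (b * m + (1 + B) * C * h ^ s) := by
    intro τ hτ
    have hτ' : τ ∈ Set.Icc (0 : ℝ) 1 := ⟨hτ.1, hτ.2.le⟩
    rw [← smul_add, norm_smul, Real.norm_of_nonneg hh.le]
    refine mul_le_mul_of_nonneg_left ((norm_add_le _ _).trans ?_) hh.le
    have h1 := D.lipschitz _ (D.mem_ball _ (hhτ τ hτ')) _ (hσ τ hτ')
    have h2 := mul_le_mul_of_nonneg_left (hme τ hτ') hC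
    have h3 := hdef τ hτ'
    have h4 : ‖f (η (h * τ)) - f (stagePoly c y₀ Y τ)‖ ≤ C * m := h1.trans h2
    rw [hb]
    linarith
  have hm_le : m ≤ h * (b * m + (1 + B) * C * h ^ s) := by
    have := norm_image_sub_le_of_norm_deriv_le_segment' (f := e) (a := 0) (b := 1)
      (fun τ hτ => (hed τ hτ).hasDerivWithinAt) hder τm hτm
    have e0 : e 0 = 0 := by
      simp only [he, mul_zero, D.init, stagePoly_zero hc0 hc, sub_self]
    rw [e0, sub_zero, sub_zero] at this
    refine this.trans (mul_le_of_le_one_right ?_ hτm.2)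
    exact (norm_nonneg _).trans (hder 0 ⟨le_rfl, one_pos⟩)
  have hm_le' : m ≤ K₁ * h ^ (s + 1) := by
    have h1 : h * (b * m) ≤ 1 / 2 * m := by
      rw [← mul_assoc]
      exact mul_le_mul_of_nonneg_right hhb (norm_nonneg _)
    rw [hK₁, pow_succ]
    nlinarith
  intro τ hτ
  have hp : h ^ (s + 1) ≤ h ^ s := pow_le_pow_of_le_one hh.le hh1 (Nat.le_succ s)
  constructor
  · refine (hme τ hτ).trans (hm_le'.trans ?_)
    exact mul_le_mul_of_nonneg_right (le_add_of_nonneg_right (by positivity)) (by positivity)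
  · refine (hdef τ hτ).trans ?_
    have h1 : C * m ≤ C * (K₁ * h ^ s) :=
      mul_le_mul_of_nonneg_left (hm_le'.trans (mul_le_mul_of_nonneg_left hp hK₁0)) hC
    calc _ ≤ (1 + B) * (C * (K₁ * h ^ s) + C * h ^ s) :=
          mul_le_mul_of_nonneg_left (by linarith) (by positivity)
      _ = (1 + B) * (C * K₁ + C) * h ^ s := by ring
      _ ≤ _ := mul_le_mul_of_nonneg_right (le_add_of_nonneg_left hK₁0) (by positivity)

theorem integral_polynomial_defect [CompleteSpace E]
    (hw : ContinuousOn (fun τ => f (stagePoly c y₀ Y τ)) (Set.Icc 0 1))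
    (P : ℕ → E →L[ℝ] E) :
    ∫ τ in (0 : ℝ)..1, (∑ i ∈ Finset.range s, τ ^ i • P i) (defect c f y₀ Y τ) = 0 := by
  have hdc : ContinuousOn (defect c f y₀ Y) (Set.Icc 0 1) :=
    hw.sub (continuous_finsetSum _ fun j _ =>
      (Polynomial.continuous _).smul continuous_const).continuousOn
  have hint : ∀ i, IntervalIntegrable (fun τ => τ ^ i • defect c f y₀ Y τ) volume 0 1 := fun i =>
    by simpa using intervalIntegrable_eval_smul hdc (X ^ i)
  have e : ∀ τ : ℝ, (∑ i ∈ Finset.range s, τ ^ i • P i) (defect c f y₀ Y τ) =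
      ∑ i ∈ Finset.range s, P i (τ ^ i • defect c f y₀ Y τ) := fun τ => by
    simp
  simp only [e]
  rw [intervalIntegral.integral_finsetSum]
  · refine Finset.sum_eq_zero fun i hi => ?_
    rw [ContinuousLinearMap.intervalIntegral_comp_comm _ (hint i)]
    have := integral_smul_sub_projection (s := s) (w := fun τ => f (stagePoly c y₀ Y τ))
      (by rwa [Set.uIcc_of_le zero_le_one]) (p := X ^ i) (by
        rw [degree_X_pow]; exact_mod_cast Finset.mem_range.1 hi)
    simp only [eval_pow, eval_X] at this
    have h2 : ∫ τ in (0 : ℝ)..1, τ ^ i • defect c f y₀ Y τ = 0 := this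
    rw [h2, map_zero]
  · intro i _
    have := (P i).continuous.comp_continuousOn ((continuous_pow i).continuousOn.smul hdc)
    rw [← Set.uIcc_of_le zero_le_one] at this
    exact this.intervalIntegrable

/-- Superconvergence at the end of the step. -/
theorem exists_norm_end_error_le [CompleteSpace E] (D : VariationalData f f' y₀ s r δ C η Φ a A)
    (hc : Function.Injective c) (hc0 : ∀ i, c i ≠ 0) :
    ∃ h₀ > 0, ∃ K, ∀ h, 0 < h → h ≤ h₀ → ∀ Y : Fin s → E, IsStages c f h y₀ Y →
      (∀ τ ∈ Set.Icc (0 : ℝ) 1, stagePoly c y₀ Y τ ∈ Metric.closedBall y₀ r) →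
      ‖stagePoly c y₀ Y 1 - η h‖ ≤ K * h ^ (2 * s + 1) := by
  obtain ⟨h₀, hh₀, hh₀δ, hh₀1, K, hK0, hK⟩ := D.exists_norm_error_le hc hc0
  have hC := D.C_nonneg
  refine ⟨h₀, hh₀, 2 * (2 * (C * K ^ 2) + C * K), fun h hh hle Y hY hσ => ?_⟩
  have hhδ : h ≤ δ := hle.trans hh₀δ
  have hh1 : h ≤ 1 := hle.trans hh₀1
  have hK' := hK h hh hle Y hY hσ
  have hhτ : ∀ τ ∈ Set.Icc (0 : ℝ) 1, h * τ ∈ Set.Icc 0 δ := fun τ hτ =>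
    ⟨mul_nonneg hh.le hτ.1, (mul_le_of_le_one_right hh.le hτ.2).trans hhδ⟩
  set σ := stagePoly c y₀ Y with hσdef
  set e : ℝ → E := fun τ => η (h * τ) - σ τ with he
  set R := defect c f y₀ Y with hR
  set Ψ : ℝ → E →L[ℝ] E := fun τ => Φ (h * τ) with hΨ
  set Q : ℝ → E →L[ℝ] E := fun τ => ∑ i ∈ Finset.range s, τ ^ i • (h ^ i • A i) with hQ
  set N : ℝ → E := fun τ => f (σ τ) - f (η (h * τ)) - f' (η (h * τ)) (σ τ - η (h * τ)) with hN
  have hσc : Continuous σ := continuous_stagePoly c y₀ Y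
  have hηd : ∀ τ ∈ Set.Icc (0 : ℝ) 1, HasDerivAt (fun τ => η (h * τ)) (h • f (η (h * τ))) τ := by
    intro τ hτ
    have h2 := (hasDerivAt_id τ).const_mul h
    rw [mul_one] at h2
    exact (D.hasDerivAt _ (hhτ τ hτ)).scomp τ h2
  have hΨd : ∀ τ ∈ Set.Icc (0 : ℝ) 1,
      HasDerivAt Ψ (h • -(Ψ τ ∘L f' (η (h * τ)))) τ := by
    intro τ hτ
    have h2 := (hasDerivAt_id τ).const_mul h
    rw [mul_one] at h2
    exact (D.hasDerivAt_adjoint _ (hhτ τ hτ)).scomp τ h2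
  have hηc : ContinuousOn (fun τ => η (h * τ)) (Set.Icc 0 1) := fun τ hτ =>
    (hηd τ hτ).continuousAt.continuousWithinAt
  have hΨc : ContinuousOn Ψ (Set.Icc 0 1) := fun τ hτ =>
    (hΨd τ hτ).continuousAt.continuousWithinAt
  have hfσ : ContinuousOn (fun τ => f (σ τ)) (Set.Icc 0 1) :=
    D.continuousOn.comp hσc.continuousOn hσ
  have hfη : ContinuousOn (fun τ => f (η (h * τ))) (Set.Icc 0 1) :=
    D.continuousOn.comp hηc fun τ hτ => D.mem_ball _ (hhτ τ hτ)
  have hf'η : ContinuousOn (fun τ => f' (η (h * τ))) (Set.Icc 0 1) :=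
    D.continuousOn_deriv.comp hηc fun τ hτ => D.mem_ball _ (hhτ τ hτ)
  have hRc : ContinuousOn R (Set.Icc 0 1) :=
    hfσ.sub (continuous_finsetSum _ fun j _ =>
      (Polynomial.continuous _).smul continuous_const).continuousOn
  have hQc : Continuous Q := by fun_prop
  have hNc : ContinuousOn N (Set.Icc 0 1) :=
    (hfσ.sub hfη).sub (hf'η.clm_apply (hσc.continuousOn.sub hηc))
  -- The adjoint equation cancels the part of e' linear in the error, leaving the defect and the
  -- quadratic remainder.
  have hd : ∀ τ ∈ Set.Icc (0 : ℝ) 1, HasDerivAt (fun τ => Ψ τ (e τ))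
      (h • Ψ τ (R τ - N τ)) τ := by
    intro τ hτ
    refine ((hΨd τ hτ).clm_apply (D.hasDerivAt_error hc hc0 hY (hhτ τ hτ))).congr_deriv ?_
    simp only [hN, hR, hσdef, _root_.smul_apply, _root_.neg_apply,
      ContinuousLinearMap.comp_apply, map_add, map_sub, map_smul, smul_sub, smul_neg]
    abel
  have hI1 : ContinuousOn (fun τ => h • Ψ τ (R τ - N τ)) (Set.Icc 0 1) :=
    (hΨc.clm_apply (hRc.sub hNc)).const_smul h
  have hI2 : ContinuousOn (fun τ => Q τ (R τ)) (Set.Icc 0 1) := hQc.continuousOn.clm_apply hRc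
  have hu := Set.uIcc_of_le (zero_le_one (α := ℝ))
  have hFTC := intervalIntegral.integral_eq_sub_of_hasDerivAt (a := 0) (b := 1)
    (f := fun τ => Ψ τ (e τ)) (f' := fun τ => h • Ψ τ (R τ - N τ))
    (fun τ hτ => hd τ (hu ▸ hτ)) (by rw [← hu] at hI1; exact hI1.intervalIntegrable)
  have e0 : e 0 = 0 := by
    simp only [he, hσdef, mul_zero, D.init, stagePoly_zero hc0 hc, sub_self]
  rw [e0, map_zero, sub_zero] at hFTC
  -- The source of superconvergence: subtracting this null integral replaces Ψ by Ψ - Q, of size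
  -- h^s, which multiplies R, also of size h^s.
  have hzero : ∫ τ in (0 : ℝ)..1, h • Q τ (R τ) = 0 := by
    rw [intervalIntegral.integral_smul, hQ, hR, integral_polynomial_defect hfσ, smul_zero]
  have hdiff : Ψ 1 (e 1) = ∫ τ in (0 : ℝ)..1, (h • Ψ τ (R τ - N τ) - h • Q τ (R τ)) := by
    rw [intervalIntegral.integral_sub, hzero, sub_zero, hFTC]
    · rw [← hu] at hI1; exact hI1.intervalIntegrable
    · have := hI2.const_smul h
      rw [← hu] at this; exact this.intervalIntegrable
  have hΨ2 : ∀ τ ∈ Set.Icc (0 : ℝ) 1, ‖Ψ τ‖ ≤ 2 := by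
    intro τ hτ
    have h1 := D.norm_adjoint_sub_one _ (hhτ τ hτ)
    have h2 : ‖(1 : E →L[ℝ] E)‖ ≤ 1 := ContinuousLinearMap.norm_id_le
    have h3 := norm_le_norm_add_norm_sub' (Φ (h * τ)) 1
    simp only [hΨ]
    linarith
  have hbound : ∀ τ ∈ Set.Icc (0 : ℝ) 1, ‖h • Ψ τ (R τ - N τ) - h • Q τ (R τ)‖ ≤
      (2 * (C * K ^ 2) + C * K) * h ^ (2 * s + 1) := by
    intro τ hτ
    have e1 : h • Ψ τ (R τ - N τ) - h • Q τ (R τ) = h • ((Ψ τ - Q τ) (R τ) - Ψ τ (N τ)) := by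
      rw [map_sub, _root_.sub_apply, ← smul_sub]
      congr 1; abel
    have hN1 : ‖N τ‖ ≤ C * (K * h ^ (s + 1)) ^ 2 := by
      refine (D.taylor_field _ (hσ τ hτ) _ (D.mem_ball _ (hhτ τ hτ))).trans ?_
      refine mul_le_mul_of_nonneg_left (pow_le_pow_left₀ (norm_nonneg _) ?_ 2) hC
      rw [norm_sub_rev]; exact (hK' τ hτ).1
    have hΨQ : ‖Ψ τ - Q τ‖ ≤ C * h ^ s := by
      have h2 := D.taylor_adjoint _ (hhτ τ hτ)
      have e2 : ∑ i ∈ Finset.range s, (h * τ) ^ i • A i = Q τ := by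
        refine Finset.sum_congr rfl fun i _ => ?_
        rw [mul_pow, mul_comm, mul_smul]
      rw [e2] at h2
      exact h2.trans (mul_le_mul_of_nonneg_left (pow_le_pow_left₀ (hhτ τ hτ).1
        (mul_le_of_le_one_right hh.le hτ.2) s) hC)
    have h3 : ‖(Ψ τ - Q τ) (R τ)‖ ≤ (C * h ^ s) * (K * h ^ s) :=
      (ContinuousLinearMap.le_opNorm _ _).trans
        (mul_le_mul hΨQ (hK' τ hτ).2 (norm_nonneg _) (by positivity))
    have h4 : ‖Ψ τ (N τ)‖ ≤ 2 * (C * (K * h ^ (s + 1)) ^ 2) :=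
      (ContinuousLinearMap.le_opNorm _ _).trans
        (mul_le_mul (hΨ2 τ hτ) hN1 (norm_nonneg _) (by norm_num))
    have hp : (h ^ (s + 1)) ^ 2 ≤ h ^ (2 * s) := by
      rw [← pow_mul]
      exact pow_le_pow_of_le_one hh.le hh1 (by omega)
    have h5 : 2 * (C * (K * h ^ (s + 1)) ^ 2) ≤ 2 * (C * K ^ 2) * h ^ (2 * s) := by
      rw [mul_pow, ← mul_assoc C, ← mul_assoc]
      exact mul_le_mul_of_nonneg_left hp (by positivity)
    rw [e1, norm_smul, Real.norm_of_nonneg hh.le]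
    calc _ ≤ h * ((2 * (C * K ^ 2) + C * K) * h ^ (2 * s)) := by
          refine mul_le_mul_of_nonneg_left ((norm_sub_le _ _).trans ?_) hh.le
          have : (C * h ^ s) * (K * h ^ s) = C * K * h ^ (2 * s) := by ring
          linarith
      _ = _ := by ring
  have hfin : ‖Ψ 1 (e 1)‖ ≤ (2 * (C * K ^ 2) + C * K) * h ^ (2 * s + 1) := by
    rw [hdiff]
    have := intervalIntegral.norm_integral_le_of_norm_le_const (a := 0) (b := 1)
      (f := fun τ => h • Ψ τ (R τ - N τ) - h • Q τ (R τ)) (fun τ hτ => hbound τ (by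
        rw [Set.uIoc_of_le zero_le_one] at hτ; exact ⟨hτ.1.le, hτ.2⟩))
    simpa using this
  -- Ψ(1) is within 1/2 of the identity, hence bounded below by 1/2; no inverse is needed.
  have hinv : ‖e 1‖ ≤ 2 * ‖Ψ 1 (e 1)‖ := by
    have h1 := D.norm_adjoint_sub_one _ (hhτ 1 ⟨zero_le_one, le_rfl⟩)
    have h2 : ‖(Ψ 1 - 1) (e 1)‖ ≤ 1 / 2 * ‖e 1‖ := ContinuousLinearMap.le_of_opNorm_le _ h1 _
    have h3 : e 1 = Ψ 1 (e 1) - (Ψ 1 - 1) (e 1) := by simp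
    have h4 := norm_sub_le (Ψ 1 (e 1)) ((Ψ 1 - 1) (e 1))
    rw [← h3] at h4
    linarith
  have e1 : σ 1 - η h = -e 1 := by simp [he]
  rw [e1, norm_neg, mul_assoc]
  exact hinv.trans (mul_le_mul_of_nonneg_left hfin (by norm_num))

end VariationalData

/-! ### Order 2s. -/

section order

variable {E : Type*} [NormedAddCommGroup E] [NormedSpace ℝ E]

theorem exists_taylor_sum_bound {s : ℕ} (hs : 1 ≤ s) {δ : ℝ} (hδ : 0 ≤ δ) {g : ℝ → E}
    (hg : ContDiffOn ℝ s g (Set.Icc 0 δ)) :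
    ∃ (a : ℕ → E) (C : ℝ), 0 ≤ C ∧ ∀ t ∈ Set.Icc 0 δ,
      ‖g t - ∑ i ∈ Finset.range s, t ^ i • a i‖ ≤ C * t ^ s := by
  obtain ⟨n, rfl⟩ : ∃ n, s = n + 1 := ⟨s - 1, by omega⟩
  obtain ⟨C, hC⟩ := exists_taylor_mean_remainder_bound hδ (n := n) (by exact_mod_cast hg)
  refine ⟨fun k => (k.factorial : ℝ)⁻¹ • iteratedDerivWithin k g (Set.Icc 0 δ) 0, |C|, abs_nonneg C,
    fun t ht => ?_⟩
  have h1 := hC t ht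
  rw [taylor_within_apply, sub_zero] at h1
  have e : ∀ k, t ^ k • ((k.factorial : ℝ)⁻¹ • iteratedDerivWithin k g (Set.Icc 0 δ) 0) =
      ((k.factorial : ℝ)⁻¹ * t ^ k) • iteratedDerivWithin k g (Set.Icc 0 δ) 0 := fun k => by
    rw [smul_smul, mul_comm]
  simp only [e]
  exact h1.trans (mul_le_mul_of_nonneg_right (le_abs_self C) (pow_nonneg ht.1 _))

/-- A `C^(2s)` vector field admits the data needed for the superconvergence estimate. -/
theorem exists_variationalData [CompleteSpace E] {s : ℕ} (hs : 1 ≤ s) {f : E → E} {U : Set E}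
    (hU : IsOpen U) (hf : ContDiffOn ℝ (2 * s : ℕ) f U) {y₀ : E} (hy₀ : y₀ ∈ U) :
    ∃ r δ C η Φ a A, VariationalData f (fderiv ℝ f) y₀ s r δ C η Φ a A := by
  have hf' : ContDiffOn ℝ (2 * s - 1 : ℕ) (fderiv ℝ f) U :=
    hf.fderiv_of_isOpen hU (by exact_mod_cast (by omega : 2 * s - 1 + 1 ≤ 2 * s))
  have hf1 : ContDiffOn ℝ (2 * s - 1 : ℕ) f U :=
    hf.of_le (by exact_mod_cast (by omega : 2 * s - 1 ≤ 2 * s))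
  have h1s : (1 : WithTop ℕ∞) ≤ (2 * s - 1 : ℕ) := by exact_mod_cast (by omega : 1 ≤ 2 * s - 1)
  -- The derivative of f is only C^(2s-1). Since s ≥ 1, this still covers the s derivatives used by
  -- the Taylor bounds.
  have hss : (s : WithTop ℕ∞) ≤ (2 * s - 1 : ℕ) := by exact_mod_cast (by omega : s ≤ 2 * s - 1)
  have hUn := hU.mem_nhds hy₀
  obtain ⟨K₁, t₁, ht₁, hK₁⟩ := ((hf1.of_le h1s).contDiffAt hUn).exists_lipschitzOnWith
  obtain ⟨K₂, t₂, ht₂, hK₂⟩ := ((hf'.of_le h1s).contDiffAt hUn).exists_lipschitzOnWith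
  obtain ⟨r, hr, hball⟩ := Metric.nhds_basis_closedBall.mem_iff.1
    (Filter.inter_mem (Filter.inter_mem ht₁ ht₂) hUn)
  -- The flow and the adjoint form one autonomous system, so a single local existence and regularity
  -- result yields both.
  set G : E × (E →L[ℝ] E) → E × (E →L[ℝ] E) := fun z => (f z.1, -(z.2 ∘L fderiv ℝ f z.1)) with hG
  have hGd : ContDiffOn ℝ (2 * s - 1 : ℕ) G (U ×ˢ Set.univ) := by
    have hm : Set.MapsTo (Prod.fst : E × (E →L[ℝ] E) → E) (U ×ˢ Set.univ) U := fun z hz => hz.1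
    exact (hf1.comp contDiff_fst.contDiffOn hm).prodMk
      ((contDiff_snd.contDiffOn.clm_comp (hf'.comp contDiff_fst.contDiffOn hm)).neg)
  have hGat : ContDiffAt ℝ 1 G (y₀, 1) := (hGd.of_le h1s).contDiffAt
    ((hU.prod isOpen_univ).mem_nhds ⟨hy₀, trivial⟩)
  obtain ⟨z, hz0, ε, hε, hz⟩ :=
    hGat.exists_forall_mem_closedBall_exists_eq_forall_mem_Ioo_hasDerivAt₀ 0
  have hzc : ContinuousAt z 0 := (hz 0 ⟨by linarith, by linarith⟩).continuousAt
  have hnear : ∀ᶠ t in nhds (0 : ℝ),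
      z t ∈ Metric.closedBall y₀ r ×ˢ Metric.closedBall (1 : E →L[ℝ] E) (1 / 2) := by
    refine hzc.eventually_mem ?_
    rw [hz0]
    exact prod_mem_nhds (Metric.closedBall_mem_nhds _ hr)
      (Metric.closedBall_mem_nhds _ (by norm_num))
  obtain ⟨δ', hδ', hδball⟩ := Metric.nhds_basis_ball.eventually_iff.1 hnear
  set δ := min (δ' / 2) (ε / 2) with hδ
  have hδ0 : 0 < δ := by positivity
  have hmem : ∀ t ∈ Set.Icc 0 δ,
      z t ∈ Metric.closedBall y₀ r ×ˢ Metric.closedBall (1 : E →L[ℝ] E) (1 / 2) := by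
    intro t ht
    refine hδball ?_
    rw [Metric.mem_ball, Real.dist_eq, sub_zero, abs_of_nonneg ht.1]
    have := ht.2.trans (min_le_left _ _)
    linarith
  have hzd : ∀ t ∈ Set.Icc 0 δ, HasDerivAt z (G (z t)) t := by
    intro t ht
    have := ht.2.trans (min_le_right _ _)
    exact hz t ⟨by linarith [ht.1], by linarith⟩
  have hzU : Set.MapsTo z (Set.Icc 0 δ) (U ×ˢ Set.univ) := fun t ht =>
    ⟨(hball (hmem t ht).1).2, trivial⟩
  have hzs : ContDiffOn ℝ s z (Set.Icc 0 δ) := by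
    refine ODE.contDiffOn_enat_Icc_of_hasDerivWithinAt (f := fun _ => G) (n := (s : ℕ∞))
      (u := U ×ˢ Set.univ) ?_ (fun t ht => (hzd t ht).hasDerivWithinAt) hzU
    exact ((hGd.of_le hss).comp contDiff_snd.contDiffOn fun x hx => hx.2)
  have hη : ContDiffOn ℝ s (fun t => f (z t).1) (Set.Icc 0 δ) :=
    (hf1.of_le hss).comp (contDiff_fst.comp_contDiffOn hzs) fun t ht => (hzU ht).1
  obtain ⟨a, C₁, hC₁0, hC₁⟩ := exists_taylor_sum_bound hs hδ0.le hη
  obtain ⟨A, C₂, hC₂0, hC₂⟩ := exists_taylor_sum_bound hs hδ0.le (contDiff_snd.comp_contDiffOn hzs)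
  set C : ℝ := K₁ + K₂ + C₁ + C₂ with hC
  have hK₁0 : (0 : ℝ) ≤ K₁ := K₁.2
  have hK₂0 : (0 : ℝ) ≤ K₂ := K₂.2
  refine ⟨r, δ, C, fun t => (z t).1, fun t => (z t).2, a, A, ?_⟩
  refine
    { r_pos := hr
      delta_pos := hδ0
      C_nonneg := by positivity
      lipschitz := fun x hx w hw => ?_
      continuousOn_deriv := hf'.continuousOn.mono fun x hx => (hball hx).2
      taylor_field := fun x hx w hw => ?_
      init := by rw [hz0]
      mem_ball := fun t ht => (hmem t ht).1
      hasDerivAt := fun t ht => (hzd t ht).fst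
      hasDerivAt_adjoint := fun t ht => (hzd t ht).snd
      norm_adjoint_sub_one := fun t ht => mem_closedBall_iff_norm.1 (hmem t ht).2
      taylor := fun t ht => ?_
      taylor_adjoint := fun t ht => ?_ }
  · have := hK₁.dist_le_mul x (hball hx).1.1 w (hball hw).1.1
    rw [dist_eq_norm, dist_eq_norm] at this
    exact this.trans (mul_le_mul_of_nonneg_right (by linarith) (norm_nonneg _))
  · have hseg : segment ℝ w x ⊆ Metric.closedBall y₀ r :=
      (convex_closedBall y₀ r).segment_subset hw hx
    have hder : ∀ u ∈ segment ℝ w x, HasFDerivWithinAt f (fderiv ℝ f u) (segment ℝ w x) u :=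
      fun u hu => (((hf1.contDiffAt (hU.mem_nhds (hball (hseg hu)).2)).differentiableAt
        (by exact (zero_lt_one.trans_le h1s).ne')).hasFDerivAt).hasFDerivWithinAt
    have hbd : ∀ u ∈ segment ℝ w x, ‖fderiv ℝ f u - fderiv ℝ f w‖ ≤ K₂ * ‖x - w‖ := by
      intro u hu
      have := hK₂.dist_le_mul u (hball (hseg hu)).1.2 w (hball hw).1.2
      rw [dist_eq_norm, dist_eq_norm] at this
      refine this.trans (mul_le_mul_of_nonneg_left ?_ hK₂0)
      obtain ⟨θ, hθ, rfl⟩ := segment_eq_image' ℝ w x ▸ hu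
      rw [add_sub_cancel_left, norm_smul, Real.norm_of_nonneg hθ.1]
      exact mul_le_of_le_one_left (norm_nonneg _) hθ.2
    have := (convex_segment w x).norm_image_sub_le_of_norm_hasFDerivWithin_le' hder hbd
      (left_mem_segment ℝ w x) (right_mem_segment ℝ w x)
    refine this.trans ?_
    rw [mul_assoc, ← sq]
    exact mul_le_mul_of_nonneg_right (by linarith) (by positivity)
  · exact (hC₁ t ht).trans (mul_le_mul_of_nonneg_right (by linarith) (pow_nonneg ht.1 _))
  · exact (hC₂ t ht).trans (mul_le_mul_of_nonneg_right (by linarith) (pow_nonneg ht.1 _))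

/-- HBVM(∞,s) has order `2s` for every vector field of class `C^(2s)`. -/
theorem hasOrderAt_of_contDiffOn [CompleteSpace E] {s : ℕ} (hs : 1 ≤ s) {c : Fin s → ℝ}
    (hc : Function.Injective c) (hc01 : ∀ i, 0 < c i ∧ c i ≤ 1) {f : E → E} {U : Set E}
    (hU : IsOpen U) (hf : ContDiffOn ℝ (2 * s : ℕ) f U) {y₀ : E} (hy₀ : y₀ ∈ U) :
    HasOrderAt c (2 * s) f U y₀ := by
  obtain ⟨r, δ, C, η, Φ, a, A, D⟩ := exists_variationalData hs hU hf hy₀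
  obtain ⟨ρ, hρ, h₁, hh₁, hσ, hex⟩ :=
    exists_radius_existsUnique_isStages hc hc01 D.r_pos D.C_nonneg D.lipschitz
  obtain ⟨h₂, hh₂, heq⟩ := D.exists_eq_of_isExactSolution U
  obtain ⟨h₃, hh₃, K, hK⟩ := D.exists_norm_end_error_le hc fun i => (hc01 i).1.ne'
  refine ⟨ρ, hρ, min h₁ (min h₂ h₃), lt_min hh₁ (lt_min hh₂ hh₃), K, fun h hh hle =>
    ⟨hex h hh (hle.trans (min_le_left _ _)), fun Y hY hYρ t₀ y hy => ?_⟩⟩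
  rw [heq h hh (hle.trans ((min_le_right _ _).trans (min_le_left _ _))) t₀ y hy]
  exact hK h hh (hle.trans ((min_le_right _ _).trans (min_le_right _ _))) Y hY (hσ Y hYρ)

/-- The field is a fixed linear image of the Fréchet derivative of `H`, so exactly one derivative is
spent. -/
theorem contDiffOn_hamiltonianField {n p : ℕ} (J : Matrix (Fin n) (Fin n) ℝ)
    {H : EuclideanSpace ℝ (Fin n) → ℝ} {U : Set (EuclideanSpace ℝ (Fin n))} (hU : IsOpen U)
    (hH : ContDiffOn ℝ ((p + 1 : ℕ) : WithTop ℕ∞) H U) :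
    ContDiffOn ℝ (p : ℕ) (hamiltonianField J H) U := by
  have h1 : ContDiffOn ℝ (p : ℕ) (fderiv ℝ H) U :=
    hH.fderiv_of_isOpen hU (by exact_mod_cast le_rfl)
  exact ((Matrix.toEuclideanLin J).toContinuousLinearMap.contDiff.comp
    (InnerProductSpace.toDual ℝ (EuclideanSpace ℝ (Fin n))).symm.contDiff).comp_contDiffOn h1

theorem hasOrder_two_mul {s : ℕ} (hs : 1 ≤ s) {c : Fin s → ℝ} (hc : Function.Injective c)
    (hc01 : ∀ i, 0 < c i ∧ c i ≤ 1) : HasOrder c (2 * s) := fun _ J _ _ _ hU hH _ hy₀ =>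
  hasOrderAt_of_contDiffOn hs hc hc01 hU (contDiffOn_hamiltonianField J hU hH) hy₀

end order

/-! ### Lower bound for the local error on the imaginary axis. -/

/-- P_s is a multiple of x^s plus terms of lower degree; were it orthogonal to x^s too, it would be
orthogonal to itself. -/
theorem integral_orthoLegendre_mul_pow_ne_zero (s : ℕ) :
    ∫ x in (0 : ℝ)..1, (orthoLegendre s).eval x * x ^ s ≠ 0 := by
  intro h0
  set l := (orthoLegendre s).coeff s
  have hd : (orthoLegendre s - C l * X ^ s).degree < (s : WithBot ℕ) := by
    rw [degree_lt_iff_coeff_zero]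
    intro m hm
    rw [coeff_sub, coeff_C_mul, coeff_X_pow]
    rcases hm.eq_or_lt with rfl | h
    · simp [l]
    · rw [coeff_eq_zero_of_natDegree_lt ((natDegree_orthoLegendre s).trans_lt h), if_neg h.ne']
      simp
  have h1 := integral_orthoLegendre_mul_eq_zero hd
  have h2 := integral_orthoLegendre_sq s
  simp only [eval_sub, eval_mul, eval_C, eval_pow, eval_X, mul_sub] at h1
  rw [intervalIntegral.integral_sub, h2] at h1
  · simp only [mul_left_comm _ l, intervalIntegral.integral_const_mul, h0] at h1
    simp at h1
  all_goals exact Continuous.intervalIntegrable (by fun_prop) _ _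

/-- Orthogonality removes all powers below s from the exponential series, so the integral is a
nonzero multiple of z^s plus O(z^(s+1)). `κ` is half the modulus of that leading coefficient; the
other half absorbs the remainder. -/
theorem exists_le_norm_integral_orthoLegendre_exp (s : ℕ) :
    ∃ κ > 0, ∃ ε > 0, ∀ z : ℂ, ‖z‖ ≤ ε →
      κ * ‖z‖ ^ s ≤ ‖∫ x in (0 : ℝ)..1, (orthoLegendre s).eval x • Complex.exp (z * x)‖ := by
  set l := ∫ x in (0 : ℝ)..1, (orthoLegendre s).eval x * x ^ s with hl
  have hl0 : 0 < |l| := abs_pos.2 (integral_orthoLegendre_mul_pow_ne_zero s)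
  obtain ⟨b, hb⟩ := (isCompact_Icc (a := (0 : ℝ)) (b := 1)).exists_bound_of_continuousOn
    (orthoLegendre s).continuous.continuousOn
  have hb0 : 0 ≤ b := (norm_nonneg _).trans (hb 0 ⟨le_rfl, zero_le_one⟩)
  set B : ℝ := ((s + 1).succ : ℝ) * (((s + 1).factorial : ℝ) * (s + 1 : ℕ))⁻¹ with hB
  have hB0 : 0 ≤ B := by positivity
  set κ := |l| / (2 * s.factorial) with hκ
  have hκ0 : 0 < κ := by positivity
  refine ⟨κ, hκ0, min 1 (κ / (b * B + 1)), by positivity, fun z hz => ?_⟩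
  have hz1 : ‖z‖ ≤ 1 := hz.trans (min_le_left _ _)
  have hzκ : b * B * ‖z‖ ≤ κ := by
    have := hz.trans (min_le_right _ _)
    rw [le_div_iff₀ (by positivity)] at this
    nlinarith [norm_nonneg z]
  set T : ℝ → ℂ := fun x => ∑ m ∈ Finset.range (s + 1), (z * x) ^ m / m.factorial with hT
  have hTc : Continuous T := by fun_prop
  have hTint : ∫ x in (0 : ℝ)..1, (orthoLegendre s).eval x • T x = (l / s.factorial) • z ^ s := by
    have e : ∀ x : ℝ, (orthoLegendre s).eval x • T x = ∑ m ∈ Finset.range (s + 1),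
        ((orthoLegendre s).eval x * x ^ m) • (z ^ m / m.factorial) := fun x => by
      rw [hT, Finset.smul_sum]
      refine Finset.sum_congr rfl fun m _ => ?_
      simp only [Complex.real_smul]; push_cast; ring
    simp only [e]
    rw [intervalIntegral.integral_finsetSum fun m _ =>
      Continuous.intervalIntegrable (by fun_prop) _ _]
    simp only [intervalIntegral.integral_smul_const]
    rw [Finset.sum_range_succ, Finset.sum_eq_zero, zero_add]
    · rw [← hl]; simp only [Complex.real_smul]; push_cast; ring
    · intro m hm
      have := integral_orthoLegendre_mul_eq_zero (n := s) (p := X ^ m) (by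
        rw [degree_X_pow]; exact_mod_cast Finset.mem_range.1 hm)
      simp only [eval_pow, eval_X] at this
      rw [this, zero_smul]
  have hrem : ‖∫ x in (0 : ℝ)..1, (orthoLegendre s).eval x • (Complex.exp (z * x) - T x)‖ ≤
      b * (‖z‖ ^ (s + 1) * B) := by
    have := intervalIntegral.norm_integral_le_of_norm_le_const (a := 0) (b := 1)
      (C := b * (‖z‖ ^ (s + 1) * B))
      (f := fun x : ℝ => (orthoLegendre s).eval x • (Complex.exp (z * x) - T x)) (fun x hx => by
        rw [Set.uIoc_of_le zero_le_one] at hx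
        have hzx : ‖z * x‖ ≤ ‖z‖ := by
          rw [norm_mul, Complex.norm_real, Real.norm_of_nonneg hx.1.le]
          exact mul_le_of_le_one_right (norm_nonneg _) hx.2
        have h1 := Complex.exp_bound (hzx.trans hz1) (n := s + 1) (Nat.succ_pos s)
        rw [norm_smul]
        refine mul_le_mul (hb x ⟨hx.1.le, hx.2⟩) (h1.trans ?_) (norm_nonneg _) hb0
        exact mul_le_mul_of_nonneg_right (pow_le_pow_left₀ (norm_nonneg _) hzx _) hB0)
    simpa using this
  have hsplit : ∫ x in (0 : ℝ)..1, (orthoLegendre s).eval x • Complex.exp (z * x) =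
      (l / s.factorial) • z ^ s +
        ∫ x in (0 : ℝ)..1, (orthoLegendre s).eval x • (Complex.exp (z * x) - T x) := by
    simp only [smul_sub]
    rw [intervalIntegral.integral_sub, hTint]
    · ring
    all_goals exact Continuous.intervalIntegrable (by fun_prop) _ _
  have hmain : ‖(l / s.factorial) • z ^ s‖ = 2 * κ * ‖z‖ ^ s := by
    rw [norm_smul, norm_pow, norm_div, Real.norm_eq_abs, hκ]
    simp only [RCLike.norm_natCast]
    field_simp
  have h1 := norm_sub_le_norm_add ((l / s.factorial) • z ^ s)
    (∫ x in (0 : ℝ)..1, (orthoLegendre s).eval x • (Complex.exp (z * x) - T x))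
  rw [← hsplit, hmain] at h1
  have h2 : b * (‖z‖ ^ (s + 1) * B) ≤ κ * ‖z‖ ^ s := by
    calc _ = b * B * ‖z‖ * ‖z‖ ^ s := by ring
      _ ≤ _ := mul_le_mul_of_nonneg_right hzκ (by positivity)
  linarith

/-- σ has degree at most s, so the P_s term is all that Π discards from it. -/
theorem sum_orthoLegendre_stagePoly {s : ℕ} {c : Fin s → ℝ} (hc : Function.Injective c)
    (hc0 : ∀ i, c i ≠ 0) (y₀ : ℂ) (Y : Fin s → ℂ) (τ : ℝ) :
    ∑ j : Fin (s + 1), (orthoLegendre j).eval τ • stageCoeff c y₀ Y j = stagePoly c y₀ Y τ := by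
  have h : ∀ j : ℕ, stageCoeff c y₀ Y j = ∑ i : Fin (s + 1),
      (∫ t in (0 : ℝ)..1, (orthoLegendre j).eval t *
        (Lagrange.basis Finset.univ (Fin.cons 0 c : Fin (s + 1) → ℝ) i).eval t) •
      (Fin.cons y₀ Y : Fin (s + 1) → ℂ) i := by
    intro j
    simp only [stageCoeff, stagePoly, Finset.smul_sum, smul_smul]
    rw [intervalIntegral.integral_finsetSum fun i _ =>
      Continuous.intervalIntegrable (by fun_prop) _ _]
    simp only [intervalIntegral.integral_smul_const]
  simp only [h, Finset.smul_sum, smul_smul]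
  rw [Finset.sum_comm, stagePoly]
  refine Finset.sum_congr rfl fun i _ => ?_
  rw [← Finset.sum_smul, sum_orthoLegendre_projection]
  rw [Lagrange.degree_basis (injective_cons_zero hc hc0).injOn (Finset.mem_univ i)]
  simp only [Finset.card_univ, Fintype.card_fin, Nat.add_sub_cancel]
  exact_mod_cast Nat.lt_succ_self s

/-- The local error for the test equation on the imaginary axis is not smaller than
a multiple of `h^(2s+1)`. -/
theorem exists_le_norm_error_test {s : ℕ} {c : Fin s → ℝ} (hc : Function.Injective c)
    (hc0 : ∀ i, c i ≠ 0) : ∃ κ > 0, ∃ ε > 0, ∀ (h : ℝ) (μ q : ℂ) (Y : Fin s → ℂ),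
      (h : ℂ) * μ = q → q.re = 0 → ‖q‖ ≤ ε → IsStages c (fun y => μ * y) h 1 Y →
      κ * ‖q‖ ^ (2 * s + 1) ≤ ‖stagePoly c 1 Y 1 - Complex.exp q‖ := by
  obtain ⟨κ, hκ, ε, hε, hI⟩ := exists_le_norm_integral_orthoLegendre_exp s
  obtain ⟨b, hb⟩ := (isCompact_Icc (a := (0 : ℝ)) (b := 1)).exists_bound_of_continuousOn
    (orthoLegendre s).continuous.continuousOn
  have hb0 : 0 ≤ b := (norm_nonneg _).trans (hb 0 ⟨le_rfl, zero_le_one⟩)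
  refine ⟨κ ^ 2 / (1 + b * b), by positivity, min ε 1, by positivity,
    fun h μ q Y hq hre hqε hY => ?_⟩
  have hq1 : ‖q‖ ≤ 1 := hqε.trans (min_le_right _ _)
  have hexp : ∀ x : ℝ, ‖Complex.exp (q * x)‖ = 1 := fun x => by
    rw [Complex.norm_exp]; simp [hre]
  have hexp' : ∀ x : ℝ, ‖Complex.exp (-q * x)‖ = 1 := fun x => by
    rw [Complex.norm_exp]; simp [hre]
  set σ := stagePoly c 1 Y with hσ
  set β := stageCoeff c 1 Y s with hβ
  have hσc : Continuous σ := continuous_stagePoly c 1 Y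
  have hderiv : ∀ τ, HasDerivAt σ (q * (σ τ - (orthoLegendre s).eval τ • β)) τ := by
    intro τ
    refine (hY.hasDerivAt_test hc hc0 hq τ).congr_deriv ?_
    have h1 := sum_orthoLegendre_stagePoly hc hc0 1 Y τ
    rw [Fin.sum_univ_castSucc] at h1
    simp only [Fin.val_castSucc, Fin.val_last] at h1
    rw [hσ, ← h1, add_sub_cancel_right]
  have hE : ∀ τ : ℝ, HasDerivAt (fun x : ℝ => Complex.exp (-q * x))
      (Complex.exp (-q * τ) * -q) τ := by
    intro τ
    have h1 := ((hasDerivAt_id (τ : ℂ)).const_mul (-q)).cexp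
    rw [mul_one] at h1
    exact h1.comp_ofReal
  set F : ℝ → ℂ := fun τ => ∫ x in (0 : ℝ)..τ, (orthoLegendre s).eval x • Complex.exp (-q * x)
    with hF
  -- Variation of constants for σ' = qσ - qβP_s, with integrating factor e^(-qτ).
  have hkey : ∀ τ : ℝ, Complex.exp (-q * τ) * σ τ = 1 - q * β * F τ := by
    intro τ
    have hd : ∀ x ∈ Set.uIcc 0 τ, HasDerivAt (fun x : ℝ => Complex.exp (-q * x) * σ x)
        (-(q * β) * ((orthoLegendre s).eval x • Complex.exp (-q * x))) x := by
      intro x _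
      refine ((hE x).fun_mul (hderiv x)).congr_deriv ?_
      simp only [Complex.real_smul]; ring
    have hFTC := intervalIntegral.integral_eq_sub_of_hasDerivAt hd
      (Continuous.intervalIntegrable (by fun_prop) _ _)
    have hσ0 : σ 0 = 1 := stagePoly_zero hc0 hc 1 Y
    rw [intervalIntegral.integral_const_mul, hσ0] at hFTC
    simp only [Complex.ofReal_zero, mul_zero, Complex.exp_zero, mul_one] at hFTC
    rw [eq_add_of_sub_eq hFTC.symm]
    ring
  have hFle : ∀ τ ∈ Set.Icc (0 : ℝ) 1, ‖F τ‖ ≤ b := by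
    intro τ hτ
    have := intervalIntegral.norm_integral_le_of_norm_le_const (a := 0) (b := τ) (C := b)
      (f := fun x : ℝ => (orthoLegendre s).eval x • Complex.exp (-q * x)) (fun x hx => by
        rw [Set.uIoc_of_le hτ.1] at hx
        rw [norm_smul, hexp', mul_one]
        exact hb x ⟨hx.1.le, hx.2.trans hτ.2⟩)
    rw [sub_zero, abs_of_nonneg hτ.1] at this
    exact this.trans (mul_le_of_le_one_right hb0 hτ.2)
  have hσF : ∀ τ : ℝ, σ τ = Complex.exp (q * τ) - q * β * (Complex.exp (q * τ) * F τ) := by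
    intro τ
    have h1 : Complex.exp (q * τ) * Complex.exp (-q * τ) = 1 := by
      rw [← Complex.exp_add, neg_mul, add_neg_cancel, Complex.exp_zero]
    linear_combination (-σ τ) * h1 + Complex.exp (q * τ) * hkey τ
  have hFc : Continuous F := intervalIntegral.continuous_primitive
    (fun a b => Continuous.intervalIntegrable (by fun_prop) _ _) 0
  -- Projecting the formula for σ onto P_s gives an equation for β itself. Its correction term is at
  -- most |β| b² for |q| ≤ 1, so β inherits the lower bound of the left side.
  have hβ_eq : (∫ x in (0 : ℝ)..1, (orthoLegendre s).eval x • Complex.exp (q * x)) =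
      β + q * β * ∫ x in (0 : ℝ)..1, (orthoLegendre s).eval x • (Complex.exp (q * x) * F x) := by
    have hβσ : β = ∫ x in (0 : ℝ)..1, (orthoLegendre s).eval x • σ x := rfl
    rw [← intervalIntegral.integral_const_mul]
    nth_rewrite 1 [hβσ]
    rw [← intervalIntegral.integral_add]
    · refine intervalIntegral.integral_congr fun x _ => ?_
      simp only [hσF x, Complex.real_smul]; ring
    · exact Continuous.intervalIntegrable ((orthoLegendre s).continuous.smul hσc) _ _
    · exact Continuous.intervalIntegrable (by fun_prop) _ _
  have hrem : ‖∫ x in (0 : ℝ)..1, (orthoLegendre s).eval x • (Complex.exp (q * x) * F x)‖ ≤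
      b * b := by
    have := intervalIntegral.norm_integral_le_of_norm_le_const (a := 0) (b := 1) (C := b * b)
      (f := fun x : ℝ => (orthoLegendre s).eval x • (Complex.exp (q * x) * F x)) (fun x hx => by
        rw [Set.uIoc_of_le zero_le_one] at hx
        have hx' : x ∈ Set.Icc (0 : ℝ) 1 := ⟨hx.1.le, hx.2⟩
        rw [norm_smul, norm_mul, hexp, one_mul]
        exact mul_le_mul (hb x hx') (hFle x hx') (norm_nonneg _) hb0)
    simpa using this
  have hβ_le : κ * ‖q‖ ^ s ≤ ‖β‖ * (1 + b * b) := by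
    refine (hI q (hqε.trans (min_le_left _ _))).trans ?_
    rw [hβ_eq]
    refine (norm_add_le _ _).trans ?_
    rw [norm_mul, norm_mul, mul_add, mul_one]
    refine add_le_add_right (mul_le_mul ?_ hrem (norm_nonneg _) (norm_nonneg _)) _
    exact mul_le_of_le_one_left (norm_nonneg _) hq1
  have hF1 : κ * ‖q‖ ^ s ≤ ‖F 1‖ := by
    have := hI (-q) (by rw [norm_neg]; exact hqε.trans (min_le_left _ _))
    rwa [norm_neg] at this
  have herr : ‖σ 1 - Complex.exp q‖ = ‖q‖ * ‖β‖ * ‖F 1‖ := by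
    have h1 := hσF 1
    have h2 := hexp 1
    rw [Complex.ofReal_one, mul_one] at h1 h2
    rw [h1, sub_sub_cancel_left, norm_neg, norm_mul, norm_mul, norm_mul, h2, one_mul]
  rw [herr, div_mul_eq_mul_div, div_le_iff₀ (by positivity)]
  calc κ ^ 2 * ‖q‖ ^ (2 * s + 1) = ‖q‖ * ((κ * ‖q‖ ^ s) * (κ * ‖q‖ ^ s)) := by ring
    _ ≤ ‖q‖ * ((‖β‖ * (1 + b * b)) * ‖F 1‖) := mul_le_mul_of_nonneg_left
        (mul_le_mul hβ_le hF1 (by positivity) (by positivity)) (norm_nonneg _)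
    _ = _ := by ring

/-! ### The harmonic oscillator as a counterexample to order 2s+1. -/

/-- The symplectic unit matrix of size two. -/
def symplecticUnit : Matrix (Fin (2 * 1)) (Fin (2 * 1)) ℝ := !![0, 1; -1, 0]

/-- The identification of the plane with `ℂ`. -/
noncomputable def planeEquiv : EuclideanSpace ℝ (Fin (2 * 1)) ≃ₗᵢ[ℝ] ℂ :=
  Complex.orthonormalBasisOneI.repr.symm

theorem hamiltonianField_oscillator (J : Matrix (Fin (2 * 1)) (Fin (2 * 1)) ℝ) :
    hamiltonianField J (fun y => (1 / 2 : ℝ) * ‖y‖ ^ 2) = Matrix.toEuclideanLin J := by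
  funext y
  have h1 : HasFDerivAt (fun y : EuclideanSpace ℝ (Fin (2 * 1)) => (1 / 2 : ℝ) * ‖y‖ ^ 2)
      (InnerProductSpace.toDual ℝ _ y) y := by
    refine ((hasStrictFDerivAt_norm_sq y).hasFDerivAt.const_mul (1 / 2 : ℝ)).congr_fderiv ?_
    ext z
    simp
  rw [hamiltonianField, (hasGradientAt_iff_hasFDerivAt.2 h1).gradient]

theorem planeEquiv_symplecticUnit (y : EuclideanSpace ℝ (Fin (2 * 1))) :
    planeEquiv (Matrix.toEuclideanLin symplecticUnit y) = -Complex.I * planeEquiv y := by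
  have h : ∀ x : EuclideanSpace ℝ (Fin 2),
      Complex.orthonormalBasisOneI.repr.symm x = (x 0 : ℂ) + x 1 * Complex.I := fun x =>
    Complex.orthonormalBasisOneI_repr_symm_apply x
  have e0 : (Matrix.toEuclideanLin symplecticUnit y) (0 : Fin 2) = y (1 : Fin 2) := by
    simp [symplecticUnit, Matrix.toLpLin_apply, dotProduct]
  have e1 : (Matrix.toEuclideanLin symplecticUnit y) (1 : Fin 2) = -y (0 : Fin 2) := by
    simp [symplecticUnit, Matrix.toLpLin_apply, dotProduct]
  have h1 := h (Matrix.toEuclideanLin symplecticUnit y)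
  have h2 := h y
  rw [e0, e1] at h1
  change Complex.orthonormalBasisOneI.repr.symm _ =
    -Complex.I * Complex.orthonormalBasisOneI.repr.symm y
  rw [h1, h2]
  push_cast
  linear_combination (y (1 : Fin 2) : ℂ) * Complex.I_sq

theorem not_hasOrder_two_mul_add_one {s : ℕ} {c : Fin s → ℝ} (hc : Function.Injective c)
    (hc0 : ∀ i, c i ≠ 0) : ¬ HasOrder c (2 * s + 1) := by
  intro hord
  have hskew : symplecticUnit.transpose = -symplecticUnit := by
    ext i j
    fin_cases i <;> fin_cases j <;> simp [symplecticUnit]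
  obtain ⟨ρ, -, h₀, hh₀, K, hK⟩ := hord 1 symplecticUnit (fun y => (1 / 2 : ℝ) * ‖y‖ ^ 2) Set.univ
    hskew isOpen_univ (contDiff_const.mul (contDiff_norm_sq ℝ)).contDiffOn (planeEquiv.symm 1)
    (Set.mem_univ _)
  rw [hamiltonianField_oscillator] at hK
  obtain ⟨κ, hκ, ε, hε, hlow⟩ := exists_le_norm_error_test hc hc0
  -- Order 2s+1 would force κ ≤ |K| h, while the last bound gives |K| h ≤ κ/2.
  set h := min (min h₀ ε) (κ / (2 * (|K| + 1))) with hh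
  have hpos : 0 < h := by positivity
  obtain ⟨⟨Y, ⟨hY, hYρ⟩, -⟩, hbound⟩ := hK h hpos ((min_le_left _ _).trans (min_le_left _ _))
  have hZ : IsStages c (fun y => -Complex.I * y) h 1 (fun i => planeEquiv (Y i)) := by
    have := hY.map (planeEquiv.toContinuousLinearEquiv : _ →L[ℝ] ℂ) (g := fun y => -Complex.I * y)
      (LinearMap.continuous_of_finiteDimensional _) planeEquiv_symplecticUnit
    have e : planeEquiv (planeEquiv.symm 1) = 1 := planeEquiv.apply_symm_apply 1
    change IsStages c _ h (planeEquiv (planeEquiv.symm 1)) _ at this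
    rwa [e] at this
  have hσ : stagePoly c 1 (fun i => planeEquiv (Y i)) 1 =
      planeEquiv (stagePoly c (planeEquiv.symm 1) Y 1) := by
    have := stagePoly_map (c := c) (planeEquiv.toLinearEquiv : _ →ₗ[ℝ] ℂ) (planeEquiv.symm 1) Y 1
    have e : planeEquiv (planeEquiv.symm 1) = 1 := planeEquiv.apply_symm_apply 1
    change stagePoly c (planeEquiv (planeEquiv.symm 1)) _ 1 = _ at this
    rwa [e] at this
  have hsol : IsExactSolution (Matrix.toEuclideanLin symplecticUnit) Set.univ 0 (0 + h)
      (planeEquiv.symm 1) (fun t => planeEquiv.symm (Complex.exp (-Complex.I * t))) := by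
    refine ⟨by simp, fun t _ => ⟨trivial, ?_⟩⟩
    have h1 := ((hasDerivAt_id (t : ℂ)).const_mul (-Complex.I)).cexp.comp_ofReal
    have h2 := planeEquiv.symm.toContinuousLinearEquiv.hasFDerivAt.comp_hasDerivAt t h1
    refine HasDerivAt.hasDerivWithinAt (h2.congr_deriv ?_)
    refine planeEquiv.injective ?_
    rw [planeEquiv_symplecticUnit]
    change planeEquiv (planeEquiv.symm _) = _
    rw [planeEquiv.apply_symm_apply, planeEquiv.apply_symm_apply, mul_one, mul_comm]
    rfl
  have hup := hbound Y hY hYρ 0 _ hsol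
  have hnq : ‖(h : ℂ) * -Complex.I‖ = h := by simp [abs_of_pos hpos]
  have hlo := hlow h (-Complex.I) (h * -Complex.I) _ rfl (by simp)
    (by rw [hnq]; exact (min_le_left _ _).trans (min_le_right _ _)) hZ
  rw [hnq, hσ] at hlo
  have hnorm : ‖planeEquiv (stagePoly c (planeEquiv.symm 1) Y 1) -
      Complex.exp ((h : ℂ) * -Complex.I)‖ = ‖stagePoly c (planeEquiv.symm 1) Y 1 -
      planeEquiv.symm (Complex.exp (-Complex.I * ((0 + h : ℝ) : ℂ)))‖ := by
    rw [← planeEquiv.norm_map (_ - _), map_sub, planeEquiv.apply_symm_apply, zero_add,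
      mul_comm (h : ℂ)]
  rw [hnorm] at hlo
  have hfin : κ * h ^ (2 * s + 1) ≤ |K| * h * h ^ (2 * s + 1) := by
    refine hlo.trans (hup.trans ?_)
    rw [pow_succ h (2 * s + 1), mul_assoc, mul_comm h]
    exact mul_le_mul_of_nonneg_right (le_abs_self K) (by positivity)
  have hκK : κ ≤ |K| * h := le_of_mul_le_mul_right hfin (by positivity)
  have hhle : h ≤ κ / (2 * (|K| + 1)) := min_le_right _ _
  rw [le_div_iff₀ (by positivity)] at hhle
  nlinarith [abs_nonneg K]

end HBVM

theorem mainTheorem6 (s : ℕ) (hs : 1 ≤ s) (c : Fin s → ℝ) (hc : Function.Injective c)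
    (hc01 : ∀ i, 0 < c i ∧ c i ≤ 1) :
    (HBVM.HasOrder c (2 * s) ∧ ¬ HBVM.HasOrder c (2 * s + 1)) ∧ HBVM.PerfectlyAStable c :=
  ⟨⟨HBVM.hasOrder_two_mul hs hc hc01,
    HBVM.not_hasOrder_two_mul_add_one hc fun i => (hc01 i).1.ne'⟩,
    HBVM.perfectlyAStable hs hc hc01⟩
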